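/- Let $\mathcal X\subseteq\mathbb R^{d_x}$, $\mathcal Y\subseteq\mathbb R^{d_y}$ be Borel sets, $P(x,dx')$ a transition kernel on $\mathcal X$ and $Q(x,dy)$ a probability kernel from $\mathcal X$ to $\mathcal Y$. Let $\{(X_n,Y_n)\}_{n\ge 0}$ (the true model) be an $\mathcal X\times\mathcal Y$-valued process on a probability space with $$P\big((X_{n+1},Y_{n+1})\in B\mid X_{0:n},Y_{0:n}\big)=\iint I_B(x,y)\,Q(x,dy)\,P(X_n,dx)\quad\text{a.s.}$$ for all $n\ge 0$ and all Borel $B\subseteq\mathcal X\times\mathcal Y$. Let $\Theta\subset\mathbb R^d$ be open, $\mu$ a finite measure on $\mathcal X$ and $\nu$ a measure on $\mathcal Y$. For $\theta\in\Theta$ let $p_\theta(x'|x)\ge 0$, $q_\theta(y|x)\ge 0$ be measurable with $\int p_\theta(x'|x)\,\mu(dx')=\int q_\theta(y|x)\,\nu(dy)=1$ for all $x\in\mathcal X$. Put $r_\theta(y,x'|x)=q_\theta(y|x')\,p_\theta(x'|x)$ and, for a probability measure $\lambda$ on $\mathcal X$, $$q^n_\theta(y_{1:n}|\lambda)=\int\cdots\int\prod_{k=1}^n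 r_\theta(y_k,x_k|x_{k-1})\,\mu(dx_n)\cdots\mu(dx_1)\,\lambda(dx_0),\qquad l_n(\theta,\lambda)=E\Big(\tfrac1n\log q^n_\theta(Y_{1:n}|\lambda)\Big).$$ For $\gamma\in(0,1)$ let $V_\gamma(\Theta)=\{\eta\in\mathbb C^d:\exists\,\theta\in\Theta,\ \|\eta-\theta\|<\gamma\}$, with the Euclidean norm. Assume: (1) There is $\varepsilon\in(0,1)$ and, for each $\theta\in\Theta$, $y\in\mathcal Y$, a finite measure $\lambda_\theta(dx|y)$ on $\mathcal X$ such that $\varepsilon\lambda_\theta(B|y)\le\int_B r_\theta(y,x'|x)\,\mu(dx')\le\lambda_\theta(B|y)/\varepsilon$ for all $x\in\mathcal X$ and Borel $B\subseteq\mathcal X$. (2) $r_\theta(y,x'|x)$ is real-analytic in $\theta\in\Theta$ and has a complex-valued continuation $\hat r_\eta(y,x'|x)$, $\eta\in\mathbb C^d$, with $\hat r_\theta=r_\theta$ for $\theta\in\Theta$, such that for some $\delta\in(0,1)$ the function $\hat r_\eta(y,x'|x)$ is analytic in $\eta\in V_\delta(\Theta)$. There are a function $\varphi_\eta(y)\in\mathbb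 C$, analytic in $\eta\in V_\delta(\Theta)$, and functions $\phi,\psi:\mathcal Y\to(0,\infty)$ with $\int\phi\,d\nu<\infty$, such that for all $\eta\in V_\delta(\Theta)$, $x,x'\in\mathcal X$, $y\in\mathcal Y$: $\varphi_\eta(y)\ne0$, $|\hat r_\eta(y,x'|x)|\le|\varphi_\eta(y)|\le\phi(y)$ and $|\log|\varphi_\eta(y)||\le\psi(y)$. (3) There is $\gamma\in(0,1)$ with $\int r_\theta(y,x'|x)\,\mu(dx')\ge\gamma|\varphi_\theta(y)|$ for all $\theta\in\Theta$, $x\in\mathcal X$, $y\in\mathcal Y$. (4) There are $K\in[1,\infty)$, $\rho\in(0,1)$ and a probability measure $\pi$ on $\mathcal X$ such that $\int\psi(y)\,Q(x,dy)\le K$ and $|P^n(x,B)-\pi(B)|\le K\rho^n$ for all $x\in\mathcal X$, $n\ge0$ and Borel $B\subseteq\mathcal X$. Then $l_n(\theta,\lambda)$ is well-defined (the density $q^n_\theta(\cdot|\lambda)$ takes values in $(0,\infty)$ and $\log q^n_\theta(Y_{1:n}|\lambda)$ is integrable), and there is a function $l:\Theta\to\mathbb R$ (the log-likelihood rate), real-analytic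 on $\Theta$, such that $\lim_{n\to\infty}l_n(\theta,\lambda)=l(\theta)$ for all $\theta\in\Theta$ and all probability measures $\lambda$ on $\mathcal X$. -/

import Mathlib

open MeasureTheory ProbabilityTheory Filter Topology
open scoped ENNReal

namespace HMMRate

noncomputable section

/-- The canonical embedding of `ℝ^d` into `ℂ^d`. -/
def toComplexVec {d : ℕ} (θ : EuclideanSpace ℝ (Fin d)) : EuclideanSpace ℂ (Fin d) :=
  WithLp.toLp 2 (fun i => ((θ i : ℝ) : ℂ))

/-- The open `γ`-vicinity `V_γ(Θ)` of `Θ ⊆ ℝ^d` in `ℂ^d`, for the Euclidean norm of `ℂ^d`. -/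
def vicinity {d : ℕ} (γ : ℝ) (Θ : Set (EuclideanSpace ℝ (Fin d))) :
    Set (EuclideanSpace ℂ (Fin d)) :=
  {η | ∃ θ ∈ Θ, ‖η - toComplexVec θ‖ < γ}

section Model

variable {d : ℕ} {X Y : Type*} [MeasurableSpace X] [MeasurableSpace Y]

/-- `p θ x' x` and `q θ y x` stand for `p_θ(x'|x)` and `q_θ(y|x)`: for each parameter in `Θ` they
are (jointly measurable, non-negative) conditional densities with respect to `μ` and `ν`. -/
structure IsDensityFamily (μ : Measure X) (ν : Measure Y) (Θ : Set (EuclideanSpace ℝ (Fin d)))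
    (p : EuclideanSpace ℝ (Fin d) → X → X → ℝ) (q : EuclideanSpace ℝ (Fin d) → Y → X → ℝ) :
    Prop where
  measurable_p : ∀ θ ∈ Θ, Measurable (fun z : X × X => p θ z.1 z.2)
  measurable_q : ∀ θ ∈ Θ, Measurable (fun z : Y × X => q θ z.1 z.2)
  p_nonneg : ∀ θ ∈ Θ, ∀ x' x, 0 ≤ p θ x' x
  q_nonneg : ∀ θ ∈ Θ, ∀ y x, 0 ≤ q θ y x
  lintegral_p : ∀ θ ∈ Θ, ∀ x, ∫⁻ x', ENNReal.ofReal (p θ x' x) ∂μ = 1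
  lintegral_q : ∀ θ ∈ Θ, ∀ x, ∫⁻ y, ENNReal.ofReal (q θ y x) ∂ν = 1

/-- The transition density `r_θ(y,x'|x) = q_θ(y|x') p_θ(x'|x)` of the candidate model. -/
def transDensity (p : EuclideanSpace ℝ (Fin d) → X → X → ℝ)
    (q : EuclideanSpace ℝ (Fin d) → Y → X → ℝ)
    (θ : EuclideanSpace ℝ (Fin d)) (y : Y) (x' x : X) : ℝ :=
  q θ y x' * p θ x' x

/-- The density `q_θ^n(y_{1:n}|λ)` of the first `n` observations of the candidate model with initial
state distribution `lam`. The coordinate `y k` is `y_{k+1}`; the state path is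
`(x₀, x 0, …, x (n-1)) = (x_0, x_1, …, x_n)`. -/
def obsDensity (μ : Measure X) (p : EuclideanSpace ℝ (Fin d) → X → X → ℝ)
    (q : EuclideanSpace ℝ (Fin d) → Y → X → ℝ) (θ : EuclideanSpace ℝ (Fin d))
    (lam : Measure X) (n : ℕ) (y : Fin n → Y) : ℝ≥0∞ :=
  ∫⁻ x₀, ∫⁻ x : Fin n → X,
    ∏ k : Fin n, ENNReal.ofReal (transDensity p q θ (y k)
      ((Fin.cons x₀ x : Fin (n + 1) → X) k.succ) ((Fin.cons x₀ x : Fin (n + 1) → X) k.castSucc))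
    ∂(Measure.pi fun _ => μ) ∂lam

/-- The average log-likelihood `(1/n) log q_θ^n(Y_{1:n}|λ)` of the observations `Y_1, …, Y_n`. -/
def avgLogLikelihood {Ω : Type*} (μ : Measure X) (p : EuclideanSpace ℝ (Fin d) → X → X → ℝ)
    (q : EuclideanSpace ℝ (Fin d) → Y → X → ℝ) (Yobs : ℕ → Ω → Y)
    (θ : EuclideanSpace ℝ (Fin d)) (lam : Measure X) (n : ℕ) (ω : Ω) : ℝ :=
  (1 / (n : ℝ)) * Real.log (obsDensity μ p q θ lam n (fun k : Fin n => Yobs (k + 1) ω)).toReal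

/-- The expected (average) log-likelihood `l_n(θ,λ)`. -/
def expLogLikelihood {Ω : Type*} [MeasurableSpace Ω] (Pr : Measure Ω)
    (μ : Measure X) (p : EuclideanSpace ℝ (Fin d) → X → X → ℝ)
    (q : EuclideanSpace ℝ (Fin d) → Y → X → ℝ) (Yobs : ℕ → Ω → Y)
    (θ : EuclideanSpace ℝ (Fin d)) (lam : Measure X) (n : ℕ) : ℝ :=
  ∫ ω, avgLogLikelihood μ p q Yobs θ lam n ω ∂Pr

/-- `(Xst n, Yobs n)` is a hidden Markov model with state transition kernel `P` and observation
kernel `Q`: the conditional law of `(X_{n+1}, Y_{n+1})` given `X_{0:n}, Y_{0:n}` is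
`P(X_n, dx) Q(x, dy)`. -/
structure IsHiddenMarkovModel {Ω : Type*} [MeasurableSpace Ω] (Pr : Measure Ω)
    (P : Kernel X X) (Q : Kernel X Y) (Xst : ℕ → Ω → X) (Yobs : ℕ → Ω → Y) : Prop where
  measurable_state : ∀ n, Measurable (Xst n)
  measurable_obs : ∀ n, Measurable (Yobs n)
  condExp_eq : ∀ (n : ℕ) (B : Set (X × Y)), MeasurableSet B →
    Pr[((fun ω => (Xst (n + 1) ω, Yobs (n + 1) ω)) ⁻¹' B).indicator (fun _ => (1 : ℝ)) |
        MeasurableSpace.comap (fun ω => fun k : Fin (n + 1) => (Xst k ω, Yobs k ω)) inferInstance]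
      =ᵐ[Pr] fun ω => (∫⁻ x, Q x {y | (x, y) ∈ B} ∂(P (Xst n ω))).toReal

/-- The mixing condition on the transition density: up to the constant factors `ε` and `1/ε`, the
measure `r_θ(y,x'|x) μ(dx')` does not depend on `x`. -/
def MixingCondition (μ : Measure X) (Θ : Set (EuclideanSpace ℝ (Fin d)))
    (p : EuclideanSpace ℝ (Fin d) → X → X → ℝ) (q : EuclideanSpace ℝ (Fin d) → Y → X → ℝ) : Prop :=
  ∃ ε : ℝ, 0 < ε ∧ ε < 1 ∧ ∀ θ ∈ Θ, ∀ y : Y, ∃ lam : Measure X, IsFiniteMeasure lam ∧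
    ∀ (x : X) (B : Set X), MeasurableSet B →
      ENNReal.ofReal ε * lam B ≤ ∫⁻ x' in B, ENNReal.ofReal (transDensity p q θ y x' x) ∂μ ∧
      ∫⁻ x' in B, ENNReal.ofReal (transDensity p q θ y x' x) ∂μ ≤ lam B / ENNReal.ofReal ε

/-- The analyticity condition: `r_θ(y,x'|x)` is real-analytic in `θ` and `rhat η y x' x` is a complex
continuation of it, analytic in `η ∈ V_δ(Θ)` and dominated there by the zero-free analytic function
`vphi η y`, where `|vphi| ≤ phi` with `phi` integrable and `|log |vphi|| ≤ psi`. -/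
structure AnalyticityCondition (ν : Measure Y) (Θ : Set (EuclideanSpace ℝ (Fin d)))
    (p : EuclideanSpace ℝ (Fin d) → X → X → ℝ) (q : EuclideanSpace ℝ (Fin d) → Y → X → ℝ)
    (δ : ℝ) (rhat : EuclideanSpace ℂ (Fin d) → Y → X → X → ℂ)
    (vphi : EuclideanSpace ℂ (Fin d) → Y → ℂ) (phi psi : Y → ℝ) : Prop where
  real_analytic : ∀ y x' x, AnalyticOnNhd ℝ (fun θ => transDensity p q θ y x' x) Θ
  delta_pos : 0 < δ
  delta_lt_one : δ < 1
  rhat_eq : ∀ θ ∈ Θ, ∀ y x' x,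
    rhat (toComplexVec θ) y x' x = ((transDensity p q θ y x' x : ℝ) : ℂ)
  rhat_analytic : ∀ y x' x, AnalyticOnNhd ℂ (fun η => rhat η y x' x) (vicinity δ Θ)
  rhat_measurable : ∀ η ∈ vicinity δ Θ, Measurable (fun z : Y × X × X => rhat η z.1 z.2.1 z.2.2)
  vphi_analytic : ∀ y, AnalyticOnNhd ℂ (fun η => vphi η y) (vicinity δ Θ)
  vphi_measurable : ∀ η ∈ vicinity δ Θ, Measurable (vphi η)
  vphi_ne_zero : ∀ η ∈ vicinity δ Θ, ∀ y, vphi η y ≠ 0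
  rhat_le : ∀ η ∈ vicinity δ Θ, ∀ y x' x, ‖rhat η y x' x‖ ≤ ‖vphi η y‖
  phi_measurable : Measurable phi
  psi_measurable : Measurable psi
  phi_pos : ∀ y, 0 < phi y
  psi_pos : ∀ y, 0 < psi y
  phi_integrable : Integrable phi ν
  vphi_le : ∀ η ∈ vicinity δ Θ, ∀ y, ‖vphi η y‖ ≤ phi y
  log_vphi_le : ∀ η ∈ vicinity δ Θ, ∀ y, |Real.log ‖vphi η y‖| ≤ psi y

/-- The lower bound `∫ r_θ(y,x'|x) μ(dx') ≥ γ |vphi_θ(y)|`. -/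
def LowerBoundCondition (μ : Measure X) (Θ : Set (EuclideanSpace ℝ (Fin d)))
    (p : EuclideanSpace ℝ (Fin d) → X → X → ℝ) (q : EuclideanSpace ℝ (Fin d) → Y → X → ℝ)
    (vphi : EuclideanSpace ℂ (Fin d) → Y → ℂ) : Prop :=
  ∃ γ : ℝ, 0 < γ ∧ γ < 1 ∧ ∀ θ ∈ Θ, ∀ (x : X) (y : Y),
    ENNReal.ofReal (γ * ‖vphi (toComplexVec θ) y‖) ≤
      ∫⁻ x', ENNReal.ofReal (transDensity p q θ y x' x) ∂μ

/-- The condition on the true chain: `∫ psi(y) Q(x,dy)` is bounded in `x`, and `P` is uniformly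
geometrically ergodic. The power `P ^ n` is the `n`-step transition kernel. -/
def TrueModelCondition (P : Kernel X X) (Q : Kernel X Y) (psi : Y → ℝ) : Prop :=
  ∃ K : ℝ, 1 ≤ K ∧ (∀ x, ∫⁻ y, ENNReal.ofReal (psi y) ∂(Q x) ≤ ENNReal.ofReal K) ∧
    ∃ π : Measure X, IsProbabilityMeasure π ∧ ∃ ρ : ℝ, 0 < ρ ∧ ρ < 1 ∧
      ∀ (x : X) (n : ℕ) (B : Set X), MeasurableSet B →
        |((P ^ n) x).real B - π.real B| ≤ K * ρ ^ n

end Model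

end

end HMMRate

/-!
For `θ ∈ Θ` the density of the observations is the mean over the initial state `x` of an iterated
integral `b n y x` of the kernel `r_θ` (`iteratedIntegral`), and the theorem is about the growth of
`E log (b n Y x)`. There are two independent parts.

*Convergence at real parameters.* By the mixing condition, `b n y x` and `b n y x'` differ by a
constant factor at most, so that `log b` is additive in blocks of observations up to a bounded error
(`IsMixingKernel.abs_log_iteratedIntegral_add`), and the initial distribution does not matter
(`abs_log_obsDensity_sub_le`). Since the true chain is uniformly ergodic, the mean of a functional of
`m` observations following time `j` converges geometrically fast in `j`, with a constant linear in
`m` (`IsHiddenMarkovModel.exists_abs_integral_block_sub_le`). Together with Fekete's lemma this gives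
the limit `l θ` (`exists_tendsto_div_of_almost_additive`).

*Analyticity of the limit.* No convergence at complex parameters is needed; a bound on `log |b|`
which is linear in `n`, on a complex ball that does not depend on `n`, suffices. The bound comes from
a perturbation argument (`IsMixingKernel.le_norm_iteratedIntegral`): near a real parameter, `b` is a
complex multiple of the real iterated integral by a factor that hardly varies with `x`, because
averaging over the tilted transition densities contracts the oscillation of this factor (Doeblin) by
more than the perturbation adds. The size of the admissible perturbation does not depend on the
observation `y`: the quotient of `r̂_η` by `φ_η` has modulus at most one, so that the Schwarz lemma
controls its variation uniformly.

On this ball `log |b|` is harmonic in each complex variable, so that the Poisson formula on a polydisc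
(`SeparatelyHarmonicOn.integral_poissonKernel`) writes the normalized expected log-likelihood at a
real parameter as a functional, bounded uniformly in `n`, applied to the Poisson kernel. The kernel
is a real-analytic function of the parameter with values in a Banach algebra of bounded continuous
functions. A weak-* cluster point of the functionals, given by the Banach-Alaoglu theorem, takes the
value `l θ` on the kernel, and is analytic as the composition of a continuous linear map with the
kernel (`analyticAt_of_tendsto_integral_harmonic`).
-/

namespace HMMRate

open scoped BoundedContinuousFunction

noncomputable section


/-! ### The Poisson integral formula on polydiscs -/

/-- The uniform probability measure on the angles `(0, 2π]`. -/
def angleMeasure : Measure ℝ :=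
  ENNReal.ofReal (2 * Real.pi)⁻¹ • volume.restrict (Set.Ioc 0 (2 * Real.pi))

instance isProbabilityMeasure_angleMeasure : IsProbabilityMeasure angleMeasure where
  measure_univ := by
    have h : (0 : ℝ) < 2 * Real.pi := by positivity
    simp only [angleMeasure, Measure.smul_apply, Measure.restrict_apply MeasurableSet.univ,
      Set.univ_inter, Real.volume_Ioc, sub_zero, smul_eq_mul]
    rw [← ENNReal.ofReal_mul (by positivity), inv_mul_cancel₀ h.ne', ENNReal.ofReal_one]

lemma circleAverage_eq_integral_angleMeasure (f : ℂ → ℝ) (c : ℂ) (R : ℝ) :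
    Real.circleAverage f c R = ∫ s, f (circleMap c R s) ∂angleMeasure := by
  have h : (0 : ℝ) < 2 * Real.pi := by positivity
  rw [Real.circleAverage_def, intervalIntegral.integral_of_le h.le, angleMeasure,
    integral_smul_measure, ENNReal.toReal_ofReal (by positivity)]

/-- The point of the distinguished boundary of the polydisc with centre `c` and radius `ρ` that has
the angles `s`. -/
def torusPoint {d : ℕ} (c : Fin d → ℂ) (ρ : ℝ) (s : Fin d → ℝ) : Fin d → ℂ :=
  fun i => circleMap (c i) ρ (s i)

lemma continuous_torusPoint {d : ℕ} (c : Fin d → ℂ) (ρ : ℝ) : Continuous (torusPoint c ρ) :=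
  continuous_pi fun i => (continuous_circleMap (c i) ρ).comp (continuous_apply i)

lemma torusPoint_mem {d : ℕ} (c : Fin d → ℂ) {ρ : ℝ} (hρ : 0 ≤ ρ) (s : Fin d → ℝ) :
    torusPoint c ρ s ∈ Metric.closedBall c ρ := by
  rw [closedBall_pi _ hρ]
  exact fun i _ => circleMap_mem_closedBall _ hρ _

/-- `U` is continuous on the closed polydisc and harmonic there in each variable separately. -/
structure SeparatelyHarmonicOn {d : ℕ} (U : (Fin d → ℂ) → ℝ) (c : Fin d → ℂ) (ρ : ℝ) : Prop where
  continuousOn : ContinuousOn U (Metric.closedBall c ρ)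
  harmonic : ∀ z ∈ Metric.closedBall c ρ, ∀ i,
    InnerProductSpace.HarmonicOnNhd (fun t => U (Function.update z i t))
      (Metric.closedBall (c i) ρ)

lemma poissonKernel_circleMap_continuous {c w : ℂ} {ρ : ℝ} (hw : w ∈ Metric.ball c ρ) :
    Continuous fun s => poissonKernel c w (circleMap c ρ s) := by
  have hρ : 0 < ρ := Metric.pos_of_mem_ball hw
  simp only [poissonKernel_def]
  refine Continuous.div (by fun_prop) (by fun_prop) fun s => ?_
  have : circleMap c ρ s ≠ w := fun h => by
    have h1 := circleMap_mem_sphere c hρ.le s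
    rw [h, mem_sphere_iff_norm] at h1
    rw [mem_ball_iff_norm] at hw
    linarith
  rw [sub_sub_sub_cancel_right]
  exact pow_ne_zero 2 (norm_ne_zero_iff.2 (sub_ne_zero.2 this))

lemma abs_poissonKernel_circleMap_le {c w : ℂ} {ρ : ℝ} (hw : w ∈ Metric.ball c ρ) (s : ℝ) :
    |poissonKernel c w (circleMap c ρ s)| ≤ ρ ^ 2 / (ρ - ‖w - c‖) ^ 2 := by
  have hρ : 0 < ρ := Metric.pos_of_mem_ball hw
  rw [mem_ball_iff_norm] at hw
  have h1 : ‖circleMap c ρ s - c‖ = ρ := by simp [abs_of_pos hρ]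
  rw [poissonKernel_def, h1]
  have h2 : ρ - ‖w - c‖ ≤ ‖(circleMap c ρ s - c) - (w - c)‖ := by
    have := norm_sub_norm_le (circleMap c ρ s - c) (w - c)
    rwa [h1] at this
  have h3 : 0 < ρ - ‖w - c‖ := by linarith
  have h4 : 0 ≤ ρ ^ 2 - ‖w - c‖ ^ 2 := by nlinarith [norm_nonneg (w - c)]
  rw [abs_of_nonneg (by positivity)]
  have h5 : ρ ^ 2 - ‖w - c‖ ^ 2 ≤ ρ ^ 2 := by nlinarith [norm_nonneg (w - c)]
  gcongr

lemma SeparatelyHarmonicOn.cons {d : ℕ} {U : (Fin (d + 1) → ℂ) → ℝ} {c : Fin (d + 1) → ℂ} {ρ : ℝ}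
    (hρ : 0 ≤ ρ) (hU : SeparatelyHarmonicOn U c ρ) {a : ℂ} (ha : a ∈ Metric.closedBall (c 0) ρ) :
    SeparatelyHarmonicOn (fun z => U (Fin.cons a z)) (Fin.tail c) ρ := by
  have hmem : ∀ z ∈ Metric.closedBall (Fin.tail c) ρ,
      (Fin.cons a z : Fin (d + 1) → ℂ) ∈ Metric.closedBall c ρ := by
    intro z hz
    rw [closedBall_pi _ hρ] at hz ⊢
    intro i _
    refine Fin.cases ?_ (fun j => ?_) i
    · simpa using ha
    · simpa [Fin.tail] using hz j (Set.mem_univ _)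
  refine ⟨hU.continuousOn.comp ?_ hmem, fun z hz i => ?_⟩
  · exact (Continuous.finCons (A := fun _ => ℂ) (continuous_const (y := a)) continuous_id).continuousOn
  · have := hU.harmonic _ (hmem z hz) i.succ
    simpa [Fin.cons_update, Fin.tail] using this

/-- **Poisson integral formula** on a polydisc, by iteration of the formula for discs. -/
theorem SeparatelyHarmonicOn.integral_poissonKernel {d : ℕ} {U : (Fin d → ℂ) → ℝ} {c : Fin d → ℂ}
    {ρ : ℝ} (hU : SeparatelyHarmonicOn U c ρ) (hρ : 0 < ρ) {w : Fin d → ℂ}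
    (hw : w ∈ Metric.ball c ρ) :
    ∫ s, (∏ i, poissonKernel (c i) (w i) (circleMap (c i) ρ (s i))) * U (torusPoint c ρ s)
      ∂(Measure.pi fun _ => angleMeasure) = U w := by
  induction d with
  | zero =>
    have h0 : ∀ z : Fin 0 → ℂ, U z = U w := fun z => congrArg U (Subsingleton.elim _ _)
    simp [h0]
  | succ d ih =>
    have hw' : ∀ i, w i ∈ Metric.ball (c i) ρ := by
      rw [ball_pi _ hρ] at hw
      exact fun i => hw i (Set.mem_univ _)
    have hcons : ∀ (a : ℝ) (s : Fin d → ℝ), torusPoint c ρ (Fin.cons a s) =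
        Fin.cons (circleMap (c 0) ρ a) (torusPoint (Fin.tail c) ρ s) := by
      intro a s
      funext i
      refine Fin.cases ?_ (fun j => ?_) i <;> simp [torusPoint, Fin.tail]
    obtain ⟨B, hB⟩ := (isCompact_closedBall c ρ).exists_bound_of_continuousOn hU.continuousOn
    have hint : Integrable (fun x : ℝ × (Fin d → ℝ) =>
        (poissonKernel (c 0) (w 0) (circleMap (c 0) ρ x.1) *
          ∏ i : Fin d, poissonKernel (c i.succ) (w i.succ) (circleMap (c i.succ) ρ (x.2 i))) *
          U (torusPoint c ρ (Fin.cons x.1 x.2)))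
        (angleMeasure.prod (Measure.pi fun _ => angleMeasure)) := by
      refine Integrable.of_bound (C := ((ρ ^ 2 / (ρ - ‖w 0 - c 0‖) ^ 2) *
        ∏ i : Fin d, ρ ^ 2 / (ρ - ‖w i.succ - c i.succ‖) ^ 2) * B) ?_ (Eventually.of_forall ?_)
      · refine Continuous.aestronglyMeasurable (Continuous.mul (Continuous.mul ?_ ?_) ?_)
        · exact (poissonKernel_circleMap_continuous (hw' 0)).comp continuous_fst
        · exact continuous_finsetProd _ fun i _ =>
            (poissonKernel_circleMap_continuous (hw' i.succ)).comp
              ((continuous_apply i).comp continuous_snd)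
        · exact hU.continuousOn.comp_continuous
            ((continuous_torusPoint c ρ).comp (Continuous.finCons (A := fun _ => ℝ) continuous_fst continuous_snd))
            fun x => torusPoint_mem c hρ.le _
      · rintro ⟨a, s⟩
        rw [Real.norm_eq_abs, abs_mul, abs_mul, Finset.abs_prod]
        gcongr
        · exact abs_poissonKernel_circleMap_le (hw' 0) _
        · exact abs_poissonKernel_circleMap_le (hw' _) _
        · exact hB _ (torusPoint_mem c hρ.le _)
    rw [← ((measurePreserving_piFinSuccAbove (fun _ => angleMeasure) 0).symm).integral_comp']
    simp_rw [MeasurableEquiv.piFinSuccAbove_symm_apply, Fin.insertNthEquiv,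
            Fin.prod_univ_succ, Fin.insertNth_zero, Equiv.coe_fn_mk, Fin.cons_succ, Fin.cons_zero,
      cast_eq]
    rw [integral_prod _ hint]
    have hinner : ∀ a : ℝ, ∫ s : Fin d → ℝ,
        (poissonKernel (c 0) (w 0) (circleMap (c 0) ρ a) *
          ∏ i : Fin d, poissonKernel (c i.succ) (w i.succ) (circleMap (c i.succ) ρ (s i))) *
          U (torusPoint c ρ (Fin.cons a s)) ∂(Measure.pi fun _ => angleMeasure) =
        poissonKernel (c 0) (w 0) (circleMap (c 0) ρ a) *
          U (Fin.cons (circleMap (c 0) ρ a) (Fin.tail w)) := by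
      intro a
      have hwt : Fin.tail w ∈ Metric.ball (Fin.tail c) ρ := by
        rw [ball_pi _ hρ]
        exact fun i _ => hw' i.succ
      have := ih (hU.cons hρ.le (circleMap_mem_closedBall (c 0) hρ.le a)) hwt
      rw [← this, ← integral_const_mul]
      simp_rw [hcons, mul_assoc]
      rfl
    rw [integral_congr_ae (Eventually.of_forall hinner)]
    have hwc : w ∈ Metric.closedBall c ρ := Metric.ball_subset_closedBall hw
    have := (hU.harmonic w hwc 0).circleAverage_poissonKernel_smul (hw' 0)
    rw [circleAverage_eq_integral_angleMeasure, Function.update_eq_self] at this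
    rw [← this]
    refine integral_congr_ae (Eventually.of_forall fun a => ?_)
    simp only [Pi.smul_apply', smul_eq_mul]
    congr 2
    conv_rhs => rw [← Fin.cons_self_tail w, Fin.update_cons_zero]


/-! ### Analytic dependence of the Poisson kernel on its centre -/

/-- The function `s ↦ ρ² + t² - 2 ρ t cos (s i)`, the denominator of the Poisson kernel at distance
`t` from the centre, as an element of a Banach algebra. -/
def poissonDenom {d : ℕ} (ρ : ℝ) (i : Fin d) (t : ℝ) : (Fin d → ℝ) →ᵇ ℝ :=
  (ρ ^ 2 + t ^ 2) • 1 - (2 * ρ * t) •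
    BoundedContinuousFunction.ofNormedAddCommGroup (fun s : Fin d → ℝ => Real.cos (s i))
      (by fun_prop) 1 (fun s => Real.abs_cos_le_one _)

lemma poissonDenom_apply {d : ℕ} (ρ : ℝ) (i : Fin d) (t : ℝ) (s : Fin d → ℝ) :
    poissonDenom ρ i t s = ρ ^ 2 + t ^ 2 - 2 * ρ * t * Real.cos (s i) := by
  simp [poissonDenom]

lemma poissonDenom_ge {d : ℕ} {ρ : ℝ} (hρ : 0 < ρ) (i : Fin d) (t : ℝ) (s : Fin d → ℝ) :
    (ρ - |t|) ^ 2 ≤ poissonDenom ρ i t s := by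
  rw [poissonDenom_apply, sub_sq, sq_abs]
  have h : t * Real.cos (s i) ≤ |t| := by
    refine (le_abs_self _).trans ?_
    rw [abs_mul]
    exact mul_le_of_le_one_right (abs_nonneg _) (Real.abs_cos_le_one _)
  nlinarith

lemma isUnit_poissonDenom {d : ℕ} {ρ : ℝ} (hρ : 0 < ρ) (i : Fin d) {t : ℝ} (ht : |t| < ρ) :
    IsUnit (poissonDenom ρ i t) := by
  have hpos : 0 < (ρ - |t|) ^ 2 := pow_pos (by linarith) 2
  have hge := poissonDenom_ge hρ i t
  refine IsUnit.of_mul_eq_one (BoundedContinuousFunction.ofNormedAddCommGroup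
      (fun s => (poissonDenom ρ i t s)⁻¹) ?_ ((ρ - |t|) ^ 2)⁻¹ fun s => ?_) ?_
  · exact (poissonDenom ρ i t).continuous.inv₀ fun s => (hpos.trans_le (hge s)).ne'
  · rw [norm_inv, Real.norm_of_nonneg (hpos.trans_le (hge s)).le]
    exact inv_anti₀ hpos (hge s)
  · ext s
    simp [(hpos.trans_le (hge s)).ne']

/-- The Poisson kernel in the `i`-th variable at the real point at distance `t` from the centre, as
a function of the angles. -/
def poissonElement {d : ℕ} (ρ : ℝ) (i : Fin d) (t : ℝ) : (Fin d → ℝ) →ᵇ ℝ :=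
  (ρ ^ 2 - t ^ 2) • Ring.inverse (poissonDenom ρ i t)

lemma analyticAt_poissonElement {d : ℕ} {ρ : ℝ} (hρ : 0 < ρ) (i : Fin d) {t : ℝ} (ht : |t| < ρ) :
    AnalyticAt ℝ (poissonElement ρ i) t := by
  have h1 : AnalyticAt ℝ (poissonDenom (d := d) ρ i) t := by
    unfold poissonDenom
    fun_prop
  have h2 : AnalyticAt ℝ (Ring.inverse : ((Fin d → ℝ) →ᵇ ℝ) → _) (poissonDenom ρ i t) :=
    analyticAt_inverse (𝕜 := ℝ) (isUnit_poissonDenom hρ i ht).unit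
  have h3 : AnalyticAt ℝ (fun t => Ring.inverse (poissonDenom (d := d) ρ i t)) t := h2.comp h1
  unfold poissonElement
  fun_prop

lemma poissonElement_apply {d : ℕ} {ρ : ℝ} (hρ : 0 < ρ) (i : Fin d) {c w : ℝ} (hw : |w - c| < ρ)
    (s : Fin d → ℝ) :
    poissonElement ρ i (w - c) s = poissonKernel (c : ℂ) (w : ℂ) (circleMap c ρ (s i)) := by
  have hne : poissonDenom ρ i (w - c) s ≠ 0 :=
    ((pow_pos (by linarith) 2).trans_le (poissonDenom_ge hρ i (w - c) s)).ne'
  have h1 : poissonDenom ρ i (w - c) s * Ring.inverse (poissonDenom ρ i (w - c)) s = 1 := by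
    rw [← BoundedContinuousFunction.mul_apply,
      Ring.mul_inverse_cancel _ (isUnit_poissonDenom hρ i hw)]
    rfl
  have h2 : ‖(circleMap (c : ℂ) ρ (s i) - c) - ((w : ℂ) - c)‖ ^ 2 = poissonDenom ρ i (w - c) s := by
    rw [poissonDenom_apply, ← Complex.normSq_eq_norm_sq, Complex.normSq_apply, circleMap,
      Complex.exp_mul_I, ← Complex.ofReal_cos, ← Complex.ofReal_sin]
    simp only [add_sub_cancel_left, Complex.sub_re, Complex.sub_im, Complex.mul_re, Complex.mul_im,
      Complex.add_re, Complex.add_im, Complex.ofReal_re, Complex.ofReal_im, Complex.I_re,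
      Complex.I_im]
    linear_combination ρ ^ 2 * Real.sin_sq_add_cos_sq (s i)
  have h3 : ‖(w : ℂ) - c‖ ^ 2 = (w - c) ^ 2 := by
    rw [← Complex.ofReal_sub, Complex.norm_real, Real.norm_eq_abs, sq_abs]
  have h4 : ‖circleMap (c : ℂ) ρ (s i) - c‖ ^ 2 = ρ ^ 2 := by simp
  rw [poissonKernel_def, h2, h3, h4, poissonElement, BoundedContinuousFunction.smul_apply,
    smul_eq_mul, eq_inv_of_mul_eq_one_right h1]
  rfl

/-- A bounded sequence of functionals has a weak-* cluster point. -/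
lemma exists_dual_of_bounded {E : Type*} [NormedAddCommGroup E] [NormedSpace ℝ E]
    (L : ℕ → E →L[ℝ] ℝ) {M : ℝ} (hL : ∀ n, ‖L n‖ ≤ M) :
    ∃ L' : E →L[ℝ] ℝ, ∀ g l, Tendsto (fun n => L n g) atTop (𝓝 l) → L' g = l := by
  obtain ⟨L', -, h⟩ := (WeakDual.isCompact_closedBall (𝕜 := ℝ) (E := E) 0 M).ultrafilter_le_nhds
    ((hyperfilter ℕ).map fun n => StrongDual.toWeakDual (L n)) (by
      rw [Ultrafilter.coe_map, le_principal_iff, mem_map]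
      exact univ_mem' fun n => by simpa using hL n)
  refine ⟨WeakDual.toStrongDual L', fun g l hl => ?_⟩
  have h1 : Tendsto (fun n => StrongDual.toWeakDual (L n) g) (hyperfilter ℕ : Filter ℕ) (𝓝 (L' g)) :=
    ((WeakDual.eval_continuous g).tendsto L').comp h
  exact tendsto_nhds_unique h1 (hl.mono_left Nat.hyperfilter_le_atTop)

/-- Limits of expectations of uniformly bounded separately harmonic functions are real-analytic:
by the Poisson formula the expectations are functionals, bounded uniformly in `n`, evaluated at the
Poisson kernel, so that the limit is a weak-* cluster point evaluated at the Poisson kernel. No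
convergence is needed off the real points. -/
theorem analyticAt_of_tendsto_integral_harmonic {d : ℕ} {Ω : Type*} [MeasurableSpace Ω]
    (Pr : Measure Ω) [IsFiniteMeasure Pr] (θ₀ : EuclideanSpace ℝ (Fin d)) {ρ : ℝ} (hρ : 0 < ρ)
    (U : ℕ → Ω → (Fin d → ℂ) → ℝ) (B : ℕ → Ω → ℝ) {M : ℝ}
    (hU : ∀ n ω, SeparatelyHarmonicOn (U n ω) (fun i => (θ₀ i : ℂ)) ρ)
    (hmeas : ∀ n, ∀ z ∈ Metric.closedBall (fun i => (θ₀ i : ℂ)) ρ, Measurable fun ω => U n ω z)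
    (hB : ∀ n ω, ∀ z ∈ Metric.closedBall (fun i => (θ₀ i : ℂ)) ρ, |U n ω z| ≤ B n ω)
    (hBint : ∀ n, Integrable (B n) Pr) (hBM : ∀ n, ∫ ω, B n ω ∂Pr ≤ M)
    (l : EuclideanSpace ℝ (Fin d) → ℝ)
    (hl : ∀ᶠ θ in 𝓝 θ₀,
      Tendsto (fun n => ∫ ω, U n ω (fun i => (θ i : ℂ)) ∂Pr) atTop (𝓝 (l θ))) :
    AnalyticAt ℝ l θ₀ := by
  set c : Fin d → ℂ := fun i => (θ₀ i : ℂ) with hc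
  set m : Measure (Fin d → ℝ) := Measure.pi fun _ => angleMeasure with hm
  have hjoint : ∀ n, Measurable fun p : (Fin d → ℝ) × Ω => U n p.2 (torusPoint c ρ p.1) := fun n =>
    measurable_uncurry_of_continuous_of_measurable
      (u := fun (s : Fin d → ℝ) (ω : Ω) => U n ω (torusPoint c ρ s))
      (fun ω => (hU n ω).continuousOn.comp_continuous (continuous_torusPoint c ρ)
        (torusPoint_mem c hρ.le))
      (fun s => hmeas n _ (torusPoint_mem c hρ.le s))
  have hint : ∀ n (g : (Fin d → ℝ) →ᵇ ℝ),
      Integrable (fun p : Ω × (Fin d → ℝ) => g p.2 * U n p.1 (torusPoint c ρ p.2)) (Pr.prod m) := by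
    intro n g
    refine Integrable.mono' (((hBint n).comp_fst m).const_mul ‖g‖) ?_
      (Eventually.of_forall fun p => ?_)
    · exact ((g.continuous.measurable.comp measurable_snd).mul
        ((hjoint n).comp measurable_swap)).aestronglyMeasurable
    · rw [norm_mul]
      exact mul_le_mul (g.norm_coe_le_norm _) (hB n _ _ (torusPoint_mem c hρ.le _))
        (norm_nonneg _) (norm_nonneg _)
  let L : ℕ → ((Fin d → ℝ) →ᵇ ℝ) →L[ℝ] ℝ := fun n => LinearMap.mkContinuous
    { toFun := fun g => ∫ p : Ω × (Fin d → ℝ), g p.2 * U n p.1 (torusPoint c ρ p.2) ∂(Pr.prod m)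
      map_add' := fun g₁ g₂ => by
        rw [← integral_add (hint n g₁) (hint n g₂)]
        simp [add_mul]
      map_smul' := fun a g => by
        rw [RingHom.id_apply, smul_eq_mul, ← integral_const_mul]
        simp [mul_assoc] } M fun g => by
      refine (norm_integral_le_of_norm_le (((hBint n).comp_fst m).const_mul ‖g‖)
        (Eventually.of_forall fun p => ?_)).trans ?_
      · rw [norm_mul]
        exact mul_le_mul (g.norm_coe_le_norm _) (hB n _ _ (torusPoint_mem c hρ.le _))
          (norm_nonneg _) (norm_nonneg _)
      · rw [integral_const_mul, mul_comm M]
        refine mul_le_mul_of_nonneg_left ?_ (norm_nonneg g)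
        rw [integral_fun_fst]
        simpa using hBM n
  have hM : 0 ≤ M := by
    refine le_trans (integral_nonneg fun ω => ?_) (hBM 0)
    exact (abs_nonneg _).trans (hB 0 ω c (Metric.mem_closedBall_self hρ.le))
  obtain ⟨L', hL'⟩ := exists_dual_of_bounded L (M := M)
    fun n => LinearMap.mkContinuous_norm_le _ hM _
  let G : EuclideanSpace ℝ (Fin d) → ((Fin d → ℝ) →ᵇ ℝ) :=
    fun θ => ∏ i, poissonElement ρ i (θ i - θ₀ i)
  have hG : AnalyticAt ℝ G θ₀ := by
    refine Finset.analyticAt_fun_prod _ fun i _ => ?_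
    have h1 : AnalyticAt ℝ (fun θ : EuclideanSpace ℝ (Fin d) => θ i - θ₀ i) θ₀ :=
      ((EuclideanSpace.proj (𝕜 := ℝ) i).analyticAt θ₀).sub analyticAt_const
    have h2 : AnalyticAt ℝ (poissonElement (d := d) ρ i) (θ₀ i - θ₀ i) :=
      analyticAt_poissonElement hρ i (by simpa using hρ)
    exact AnalyticAt.comp (f := fun θ : EuclideanSpace ℝ (Fin d) => θ i - θ₀ i) h2 h1
  refine ((L'.analyticAt _).comp hG).congr ?_
  have hnear : ∀ᶠ θ in 𝓝 θ₀, ∀ i, |θ i - θ₀ i| < ρ := by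
    rw [eventually_all]
    intro i
    have h1 : Tendsto (fun θ : EuclideanSpace ℝ (Fin d) => |θ i - θ₀ i|) (𝓝 θ₀)
        (𝓝 |θ₀ i - θ₀ i|) :=
      (((EuclideanSpace.proj (𝕜 := ℝ) i).continuous.sub continuous_const).abs).tendsto θ₀
    exact h1.eventually_lt_const (by simpa using hρ)
  filter_upwards [hl, hnear] with θ hθ hθρ
  refine hL' _ _ (hθ.congr fun n => ?_)
  have hw : (fun i => (θ i : ℂ)) ∈ Metric.ball c ρ := by
    rw [ball_pi _ hρ]
    intro i _
    rw [mem_ball_iff_norm, hc, ← Complex.ofReal_sub, Complex.norm_real]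
    exact hθρ i
  calc ∫ ω, U n ω (fun i => (θ i : ℂ)) ∂Pr
      = ∫ ω, ∫ s, G θ s * U n ω (torusPoint c ρ s) ∂m ∂Pr := by
        refine integral_congr_ae (Eventually.of_forall fun ω => ?_)
        beta_reduce
        rw [← (hU n ω).integral_poissonKernel hρ hw]
        refine integral_congr_ae (Eventually.of_forall fun s => ?_)
        simp only [G, BoundedContinuousFunction.coe_prod, Finset.prod_apply]
        congr 1
        exact Finset.prod_congr rfl fun i _ => (poissonElement_apply hρ i (hθρ i) s).symm
    _ = L n (G θ) := (integral_prod _ (hint n (G θ))).symm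


/-! ### Iterated integrals of kernels -/

section Iterated

variable {X Y 𝕜 : Type*} [MeasurableSpace X] [RCLike 𝕜]

/-- The iterated integral `∫⋯∫ ∏ r(y_k, x_{k+1}, x_k) μ(dx_n)⋯μ(dx_1)` as a function of the initial
point `x_0 = x`; the sequence `y` enters through its first `n` terms. It is defined by integrating
out the first step last, that is, by backward recursion. -/
def iteratedIntegral (μ : Measure X) (r : Y → X → X → 𝕜) : ℕ → (ℕ → Y) → X → 𝕜
  | 0, _, _ => 1
  | n + 1, y, x => ∫ x', r (y 0) x' x * iteratedIntegral μ r n (fun k => y (k + 1)) x' ∂μ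

variable {μ : Measure X} {r : Y → X → X → 𝕜} {a : Y → ℝ}

lemma iteratedIntegral_zero (y : ℕ → Y) (x : X) : iteratedIntegral μ r 0 y x = 1 := rfl

lemma iteratedIntegral_succ (n : ℕ) (y : ℕ → Y) (x : X) : iteratedIntegral μ r (n + 1) y x =
    ∫ x', r (y 0) x' x * iteratedIntegral μ r n (fun k => y (k + 1)) x' ∂μ := rfl

lemma iteratedIntegral_congr {r' : Y → X → X → 𝕜} {n : ℕ} {y y' : ℕ → Y} (x : X)
    (h : ∀ k < n, ∀ x' x, r (y k) x' x = r' (y' k) x' x) :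
    iteratedIntegral μ r n y x = iteratedIntegral μ r' n y' x := by
  induction n generalizing y y' x with
  | zero => rfl
  | succ n ih =>
    rw [iteratedIntegral_succ, iteratedIntegral_succ]
    congr 1
    funext x'
    rw [h 0 n.succ_pos, ih (y' := fun k => y' (k + 1)) x' fun k hk => h (k + 1) (by omega)]

lemma iteratedIntegral_mul_left (w : Y → 𝕜) (n : ℕ) (y : ℕ → Y) (x : X) :
    iteratedIntegral μ (fun y x' x => w y * r y x' x) n y x =
      (∏ k ∈ Finset.range n, w (y k)) * iteratedIntegral μ r n y x := by
  induction n generalizing y x with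
  | zero => simp [iteratedIntegral_zero]
  | succ n ih =>
    rw [iteratedIntegral_succ, iteratedIntegral_succ, Finset.prod_range_succ',
      ← integral_const_mul]
    congr 1
    funext x'
    rw [ih]
    ring

lemma iteratedIntegral_ofReal (r : Y → X → X → ℝ) (n : ℕ) (y : ℕ → Y) (x : X) :
    iteratedIntegral μ (fun y x' x => (r y x' x : ℂ)) n y x =
      ((iteratedIntegral μ r n y x : ℝ) : ℂ) := by
  induction n generalizing y x with
  | zero => simp [iteratedIntegral_zero]
  | succ n ih =>
    rw [iteratedIntegral_succ, iteratedIntegral_succ, ← integral_complex_ofReal]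
    congr 1
    funext x'
    rw [ih, Complex.ofReal_mul]

variable [IsFiniteMeasure μ]

lemma norm_iteratedIntegral_le (ha : ∀ y x' x, ‖r y x' x‖ ≤ a y) (n : ℕ) (y : ℕ → Y) (x : X) :
    ‖iteratedIntegral μ r n y x‖ ≤ ∏ k ∈ Finset.range n, (μ.real Set.univ * a (y k)) := by
  induction n generalizing y x with
  | zero => simp [iteratedIntegral_zero]
  | succ n ih =>
    rw [iteratedIntegral_succ, Finset.prod_range_succ']
    refine (norm_integral_le_of_norm_le_const (C := a (y 0) *
      ∏ k ∈ Finset.range n, (μ.real Set.univ * a (y (k + 1)))) (Eventually.of_forall fun x' => ?_)).trans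
      (le_of_eq (by ring))
    rw [norm_mul]
    exact mul_le_mul (ha _ _ _) (ih _ _) (norm_nonneg _) ((norm_nonneg _).trans (ha _ x' x))

variable [MeasurableSpace Y]

lemma measurable_iteratedIntegral (hr : Measurable fun z : Y × X × X => r z.1 z.2.1 z.2.2) (n : ℕ) :
    Measurable fun z : (ℕ → Y) × X => iteratedIntegral μ r n z.1 z.2 := by
  induction n with
  | zero => exact measurable_const
  | succ n ih =>
    simp only [iteratedIntegral_succ]
    refine StronglyMeasurable.measurable (StronglyMeasurable.integral_prod_right
      (f := fun (z : (ℕ → Y) × X) (x' : X) =>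
        r (z.1 0) x' z.2 * iteratedIntegral μ r n (fun k => z.1 (k + 1)) x') ?_)
    refine Measurable.stronglyMeasurable (Measurable.mul ?_ ?_)
    · exact hr.comp (f := fun w : ((ℕ → Y) × X) × X => (w.1.1 0, w.2, w.1.2)) (by fun_prop)
    · exact ih.comp (f := fun w : ((ℕ → Y) × X) × X => ((fun k => w.1.1 (k + 1)), w.2))
        (by fun_prop)

lemma measurable_iteratedIntegral_right (hr : Measurable fun z : Y × X × X => r z.1 z.2.1 z.2.2)
    (n : ℕ) (y : ℕ → Y) : Measurable (iteratedIntegral μ r n y) :=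
  (measurable_iteratedIntegral hr n).comp (measurable_const.prodMk measurable_id)

lemma measurable_iteratedIntegral_left (hr : Measurable fun z : Y × X × X => r z.1 z.2.1 z.2.2)
    (n : ℕ) (x : X) : Measurable fun y : ℕ → Y => iteratedIntegral μ r n y x :=
  (measurable_iteratedIntegral hr n).comp (measurable_id.prodMk measurable_const)

lemma integrable_mul_iteratedIntegral (hr : Measurable fun z : Y × X × X => r z.1 z.2.1 z.2.2)
    (ha : ∀ y x' x, ‖r y x' x‖ ≤ a y) (n : ℕ) (y₀ : Y) (y : ℕ → Y) (x : X) :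
    Integrable (fun x' => r y₀ x' x * iteratedIntegral μ r n y x') μ := by
  refine Integrable.of_bound (C := a y₀ * ∏ k ∈ Finset.range n, (μ.real Set.univ * a (y k)))
    (Measurable.aestronglyMeasurable ?_) (Eventually.of_forall fun x' => ?_)
  · exact (hr.comp (f := fun x' => (y₀, x', x)) (by fun_prop)).mul
      (measurable_iteratedIntegral_right hr n y)
  · rw [norm_mul]
    exact mul_le_mul (ha _ _ _) (norm_iteratedIntegral_le ha _ _ _) (norm_nonneg _)
      ((norm_nonneg _).trans (ha _ x' x))

end Iterated

/-! ### Mixing kernels -/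

section Mixing

variable {X Y : Type*} [MeasurableSpace X] [MeasurableSpace Y]

/-- A non-negative kernel `r(y,x',x)` with densities comparable, up to the factor `κ`, for any two
values of `x`, and with total mass of the order of the upper bound `a y`. -/
structure IsMixingKernel (μ : Measure X) (r : Y → X → X → ℝ) (a : Y → ℝ) (γ κ : ℝ) : Prop where
  measurable : Measurable fun z : Y × X × X => r z.1 z.2.1 z.2.2
  gamma_pos : 0 < γ
  kappa_pos : 0 < κ
  kappa_le_one : κ ≤ 1
  bound_pos : ∀ y, 0 < a y
  nonneg : ∀ y x' x, 0 ≤ r y x' x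
  le_bound : ∀ y x' x, r y x' x ≤ a y
  lower : ∀ y x, γ * a y ≤ ∫ x', r y x' x ∂μ
  compare : ∀ y x₁ x₂, ∀ᵐ x' ∂μ, κ * r y x' x₁ ≤ r y x' x₂

namespace IsMixingKernel

variable {μ : Measure X} {r : Y → X → X → ℝ} {a : Y → ℝ} {γ κ : ℝ}

lemma norm_le (hr : IsMixingKernel μ r a γ κ) (y : Y) (x' x : X) : ‖r y x' x‖ ≤ a y := by
  rw [Real.norm_of_nonneg (hr.nonneg _ _ _)]
  exact hr.le_bound _ _ _

variable [IsFiniteMeasure μ]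

lemma integrable (hr : IsMixingKernel μ r a γ κ) (y : Y) (x : X) :
    Integrable (fun x' => r y x' x) μ :=
  Integrable.of_bound (C := a y)
    ((hr.measurable.comp (f := fun x' => (y, x', x)) (by fun_prop)).aestronglyMeasurable)
    (Eventually.of_forall fun x' => hr.norm_le _ _ _)

lemma le_iteratedIntegral (hr : IsMixingKernel μ r a γ κ) (n : ℕ) (y : ℕ → Y) (x : X) :
    ∏ k ∈ Finset.range n, (γ * a (y k)) ≤ iteratedIntegral μ r n y x := by
  induction n generalizing y x with
  | zero => simp [iteratedIntegral_zero]
  | succ n ih =>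
    have h0 : 0 ≤ ∏ k ∈ Finset.range n, (γ * a (y (k + 1))) :=
      Finset.prod_nonneg fun k _ => mul_nonneg hr.gamma_pos.le (hr.bound_pos _).le
    rw [iteratedIntegral_succ, Finset.prod_range_succ']
    calc _ ≤ (∏ k ∈ Finset.range n, (γ * a (y (k + 1)))) * ∫ x', r (y 0) x' x ∂μ :=
          mul_le_mul_of_nonneg_left (hr.lower _ _) h0
      _ = ∫ x', r (y 0) x' x * ∏ k ∈ Finset.range n, (γ * a (y (k + 1))) ∂μ := by
          rw [integral_mul_const, mul_comm]
      _ ≤ _ := integral_mono ((hr.integrable _ _).mul_const _)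
          (integrable_mul_iteratedIntegral hr.measurable hr.norm_le _ _ _ _)
          fun x' => mul_le_mul_of_nonneg_left (ih _ _) (hr.nonneg _ _ _)

lemma iteratedIntegral_pos (hr : IsMixingKernel μ r a γ κ) (n : ℕ) (y : ℕ → Y) (x : X) :
    0 < iteratedIntegral μ r n y x :=
  (Finset.prod_pos fun _ _ => mul_pos hr.gamma_pos (hr.bound_pos _)).trans_le
    (hr.le_iteratedIntegral n y x)

lemma compare_iteratedIntegral (hr : IsMixingKernel μ r a γ κ) (n : ℕ) (y : ℕ → Y) (x₁ x₂ : X) :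
    κ * iteratedIntegral μ r n y x₁ ≤ iteratedIntegral μ r n y x₂ := by
  cases n with
  | zero => simpa [iteratedIntegral_zero] using hr.kappa_le_one
  | succ n =>
    rw [iteratedIntegral_succ, iteratedIntegral_succ, ← integral_const_mul]
    refine integral_mono_ae
      ((integrable_mul_iteratedIntegral hr.measurable hr.norm_le _ _ _ _).const_mul _)
      (integrable_mul_iteratedIntegral hr.measurable hr.norm_le _ _ _ _) ?_
    filter_upwards [hr.compare (y 0) x₁ x₂] with x' hx'
    rw [← mul_assoc]
    exact mul_le_mul_of_nonneg_right hx' (hr.iteratedIntegral_pos _ _ _).le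

lemma le_iteratedIntegral_add (hr : IsMixingKernel μ r a γ κ) (n m : ℕ) (y : ℕ → Y) (x x₀ : X) :
    κ * (iteratedIntegral μ r n y x * iteratedIntegral μ r m (fun k => y (k + n)) x₀) ≤
      iteratedIntegral μ r (n + m) y x := by
  induction n generalizing y x with
  | zero => simpa [iteratedIntegral_zero] using hr.compare_iteratedIntegral m y x₀ x
  | succ n ih =>
    rw [Nat.succ_add, iteratedIntegral_succ, iteratedIntegral_succ, ← integral_mul_const,
      ← integral_const_mul]
    refine integral_mono
      (((integrable_mul_iteratedIntegral hr.measurable hr.norm_le _ _ _ _).mul_const _).const_mul _)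
      (integrable_mul_iteratedIntegral hr.measurable hr.norm_le _ _ _ _) fun x' => ?_
    refine le_trans (le_of_eq ?_) (mul_le_mul_of_nonneg_left (ih _ x') (hr.nonneg _ _ _))
    simp only [add_assoc]
    ring

lemma iteratedIntegral_add_le (hr : IsMixingKernel μ r a γ κ) (n m : ℕ) (y : ℕ → Y) (x x₀ : X) :
    κ * iteratedIntegral μ r (n + m) y x ≤
      iteratedIntegral μ r n y x * iteratedIntegral μ r m (fun k => y (k + n)) x₀ := by
  induction n generalizing y x with
  | zero => simpa [iteratedIntegral_zero] using hr.compare_iteratedIntegral m y x x₀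
  | succ n ih =>
    rw [Nat.succ_add, iteratedIntegral_succ, iteratedIntegral_succ, ← integral_mul_const,
      ← integral_const_mul]
    refine integral_mono
      ((integrable_mul_iteratedIntegral hr.measurable hr.norm_le _ _ _ _).const_mul _)
      ((integrable_mul_iteratedIntegral hr.measurable hr.norm_le _ _ _ _).mul_const _) fun x' => ?_
    have := mul_le_mul_of_nonneg_left (ih (fun k => y (k + 1)) x') (hr.nonneg (y 0) x' x)
    refine le_trans (le_of_eq ?_) (this.trans (le_of_eq ?_))
    · ring
    · simp only [add_assoc]
      ring

/-- The logarithm of the iterated integral is additive up to a bounded error. -/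
lemma abs_log_iteratedIntegral_add (hr : IsMixingKernel μ r a γ κ) (n m : ℕ) (y : ℕ → Y)
    (x x₀ : X) :
    |Real.log (iteratedIntegral μ r (n + m) y x) - Real.log (iteratedIntegral μ r n y x) -
      Real.log (iteratedIntegral μ r m (fun k => y (k + n)) x₀)| ≤ -Real.log κ := by
  have h1 := hr.iteratedIntegral_pos n y x
  have h2 := hr.iteratedIntegral_pos m (fun k => y (k + n)) x₀
  have h3 := hr.iteratedIntegral_pos (n + m) y x
  have hκ := hr.kappa_pos
  have h4 := Real.log_le_log (by positivity) (hr.le_iteratedIntegral_add n m y x x₀)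
  have h5 := Real.log_le_log (by positivity) (hr.iteratedIntegral_add_le n m y x x₀)
  rw [Real.log_mul hκ.ne' (by positivity), Real.log_mul h1.ne' h2.ne'] at h4
  rw [Real.log_mul hκ.ne' h3.ne', Real.log_mul h1.ne' h2.ne'] at h5
  rw [abs_le]
  constructor <;> linarith

end IsMixingKernel

end Mixing


/-! ### Complex perturbations of mixing kernels -/

section Perturbation

variable {X Y : Type*} [MeasurableSpace X] [MeasurableSpace Y]
variable {μ : Measure X} {r : Y → X → X → ℝ} {a : Y → ℝ} {γ κ : ℝ}

lemma norm_average_sub_le {g : X → ℝ} {f : X → ℂ} (hg : Integrable g μ) (hg0 : ∀ x, 0 ≤ g x)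
    (hg1 : ∫ x, g x ∂μ = 1) (hgf : Integrable (fun x => (g x : ℂ) * f x) μ) {D : ℝ} (z : ℂ)
    (hD : ∀ x, ‖f x - z‖ ≤ D) : ‖(∫ x, (g x : ℂ) * f x ∂μ) - z‖ ≤ D := by
  have h1 : (∫ x, (g x : ℂ) * f x ∂μ) - z = ∫ x, (g x : ℂ) * (f x - z) ∂μ := by
    have h2 : Integrable (fun x => (g x : ℂ) * z) μ := hg.ofReal.mul_const z
    simp_rw [mul_sub]
    rw [integral_sub hgf h2, integral_mul_const, integral_complex_ofReal, hg1]
    simp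
  rw [h1]
  refine (norm_integral_le_of_norm_le (hg.mul_const D) (Eventually.of_forall fun x => ?_)).trans ?_
  · rw [norm_mul, Complex.norm_real, Real.norm_of_nonneg (hg0 x)]
    exact mul_le_mul_of_nonneg_left (hD x) (hg0 x)
  · rw [integral_mul_const, hg1, one_mul]

/-- Doeblin's contraction of the oscillation, for complex-valued functions. -/
lemma norm_average_sub_average_le {g₁ g₂ : X → ℝ} {f : X → ℂ} {D α : ℝ}
    (hg₁ : Integrable g₁ μ) (hg₂ : Integrable g₂ μ) (hg₂0 : ∀ x, 0 ≤ g₂ x)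
    (hg₁1 : ∫ x, g₁ x ∂μ = 1) (hg₂1 : ∫ x, g₂ x ∂μ = 1)
    (hgf₁ : Integrable (fun x => (g₁ x : ℂ) * f x) μ)
    (hgf₂ : Integrable (fun x => (g₂ x : ℂ) * f x) μ)
    (hα : ∀ᵐ x ∂μ, α * g₂ x ≤ g₁ x) (hD : ∀ x x', ‖f x - f x'‖ ≤ D) :
    ‖(∫ x, (g₁ x : ℂ) * f x ∂μ) - ∫ x, (g₂ x : ℂ) * f x ∂μ‖ ≤ (1 - α) * D := by
  set F := ∫ x, (g₂ x : ℂ) * f x ∂μ with hF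
  have hfF : ∀ x, ‖f x - F‖ ≤ D := fun x => by
    rw [norm_sub_rev]
    exact norm_average_sub_le hg₂ hg₂0 hg₂1 hgf₂ (f x) fun x' => hD x' x
  -- subtracting `α g₂` from `g₁` costs nothing, as `f - F` has mean zero under `g₂`
  have h1 : (∫ x, (g₁ x : ℂ) * f x ∂μ) - F =
      ∫ x, ((g₁ x - α * g₂ x : ℝ) : ℂ) * (f x - F) ∂μ := by
    have e1 : ∀ x, ((g₁ x - α * g₂ x : ℝ) : ℂ) * (f x - F) =
        ((g₁ x : ℂ) * f x - (g₁ x : ℂ) * F) - α * ((g₂ x : ℂ) * f x - (g₂ x : ℂ) * F) := by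
      intro x
      push_cast
      ring
    have e2 : Integrable (fun x => (g₁ x : ℂ) * F) μ := hg₁.ofReal.mul_const F
    have e3 : Integrable (fun x => (g₂ x : ℂ) * F) μ := hg₂.ofReal.mul_const F
    have e4 : Integrable (fun x => (g₁ x : ℂ) * f x - (g₁ x : ℂ) * F) μ := hgf₁.sub e2
    have e5 : Integrable (fun x => (α : ℂ) * ((g₂ x : ℂ) * f x - (g₂ x : ℂ) * F)) μ :=
      (hgf₂.sub e3).const_mul _
    simp_rw [e1]
    rw [integral_sub e4 e5, integral_const_mul, integral_sub hgf₁ e2, integral_sub hgf₂ e3, integral_mul_const, integral_mul_const,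
      integral_complex_ofReal, integral_complex_ofReal, hg₁1, hg₂1, ← hF]
    simp
  rw [h1]
  have hint : Integrable (fun x => (g₁ x - α * g₂ x) * D) μ :=
    (hg₁.sub (hg₂.const_mul α)).mul_const D
  refine (norm_integral_le_of_norm_le hint ?_).trans ?_
  · filter_upwards [hα] with x hx
    rw [norm_mul, Complex.norm_real, Real.norm_of_nonneg (by linarith)]
    exact mul_le_mul_of_nonneg_left (hfF x) (by linarith)
  · rw [integral_mul_const, integral_sub hg₁ (hg₂.const_mul α), integral_const_mul, hg₁1, hg₂1,
      mul_one]

variable [IsFiniteMeasure μ]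

/-- One step of the perturbation argument. If `f` oscillates little compared with its smallest
modulus, so does the quotient of the perturbed kernel applied to `u f` by the unperturbed one
applied to `u`: averaging contracts the oscillation by the factor `1 - κ²`, which leaves room for
the error caused by the perturbation. -/
lemma IsMixingKernel.perturbed_step (hr : IsMixingKernel μ r a γ κ) {y : Y} {s : X → X → ℂ}
    {τ σ : ℝ} (hs : ∀ x, Measurable fun x' => s x' x)
    (hsr : ∀ x' x, ‖s x' x - r y x' x‖ ≤ τ * a y) {u : X → ℝ} (hu : Measurable u)
    (hu0 : ∀ x, 0 < u x) (hu1 : ∀ x₁ x₂, κ * u x₁ ≤ u x₂) {f : X → ℂ} (hf : Measurable f)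
    (hσ : 2 * τ * μ.real Set.univ ≤ σ * (γ * κ ^ 2)) (hσ' : σ ≤ κ ^ 4 / 12)
    (hosc : ∀ x x' x'', ‖f x - f x'‖ ≤ κ ^ 2 / 2 * ‖f x''‖) {f' : X → ℂ}
    (hf' : ∀ x, f' x = (∫ x', s x' x * (u x' * f x') ∂μ) / ((∫ x', r y x' x * u x' ∂μ : ℝ) : ℂ)) :
    (∀ x x' x'', ‖f' x - f' x'‖ ≤ κ ^ 2 / 2 * ‖f' x''‖) ∧ ∀ x p, 1 / 4 * ‖f p‖ ≤ ‖f' x‖ := by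
  have hκ := hr.kappa_pos
  have hγ := hr.gamma_pos
  have ha := hr.bound_pos y
  have hκ2 : κ ^ 2 ≤ 1 := pow_le_one₀ hκ.le hr.kappa_le_one
  have hτa : ∀ x x' : X, 0 ≤ τ * a y := fun x x' => (norm_nonneg _).trans (hsr x' x)
  suffices key : ∀ p, (∀ x x', ‖f' x - f' x'‖ ≤ ((1 - κ ^ 2) * (κ ^ 2 / 2) + 2 * σ) * ‖f p‖) ∧
      ∀ x, (1 - κ ^ 2 / 2 - σ) * ‖f p‖ ≤ ‖f' x‖ by
    have h4 : κ ^ 4 = κ ^ 2 * κ ^ 2 := by ring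
    refine ⟨fun x x' x'' => ?_, fun x p => ?_⟩
    · refine ((key x).1 x x').trans ?_
      refine le_trans ?_ (mul_le_mul_of_nonneg_left ((key x).2 x'') (by positivity))
      rw [← mul_assoc]
      refine mul_le_mul_of_nonneg_right ?_ (norm_nonneg _)
      nlinarith [mul_le_mul_of_nonneg_left hσ' (sq_nonneg κ), pow_pos hκ 4]
    · refine le_trans (mul_le_mul_of_nonneg_right ?_ (norm_nonneg _)) ((key p).2 x)
      nlinarith [pow_pos hκ 4]
  intro p
  have hup := hu0 p
  have hf2 : ∀ x, ‖f x‖ ≤ 2 * ‖f p‖ := fun x => by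
    have h1 := hosc x p p
    have h2 := norm_le_norm_add_norm_sub (f p) (f x)
    rw [norm_sub_rev] at h2
    nlinarith [norm_nonneg (f p)]
  have hu2 : ∀ x, u x ≤ u p / κ := fun x => by
    rw [le_div_iff₀ hκ, mul_comm]
    exact hu1 x p
  have hrm : ∀ x, Measurable fun x' => r y x' x := fun x =>
    hr.measurable.comp (f := fun x' => (y, x', x)) (by fun_prop)
  have hru : ∀ x, Integrable (fun x' => r y x' x * u x') μ := fun x => by
    refine Integrable.of_bound (C := a y * (u p / κ)) ((hrm x).mul hu).aestronglyMeasurable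
      (Eventually.of_forall fun x' => ?_)
    rw [norm_mul, Real.norm_of_nonneg (hu0 x').le]
    exact mul_le_mul (hr.norm_le _ _ _) (hu2 x') (hu0 x').le ha.le
  set v : X → ℝ := fun x => ∫ x', r y x' x * u x' ∂μ with hv
  have hvp : ∀ x, γ * a y * (κ * u p) ≤ v x := fun x => by
    calc γ * a y * (κ * u p) ≤ (∫ x', r y x' x ∂μ) * (κ * u p) :=
          mul_le_mul_of_nonneg_right (hr.lower y x) (by positivity)
      _ = ∫ x', r y x' x * (κ * u p) ∂μ := (integral_mul_const _ _).symm
      _ ≤ v x := integral_mono ((hr.integrable y x).mul_const _) (hru x)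
          fun x' => mul_le_mul_of_nonneg_left (hu1 p x') (hr.nonneg _ _ _)
  have hv0 : ∀ x, 0 < v x := fun x => lt_of_lt_of_le (by positivity) (hvp x)
  have hv1 : ∀ x₁ x₂, κ * v x₁ ≤ v x₂ := fun x₁ x₂ => by
    rw [hv]
    beta_reduce
    rw [← integral_const_mul]
    refine integral_mono_ae ((hru x₁).const_mul _) (hru x₂) ?_
    filter_upwards [hr.compare y x₁ x₂] with x' hx'
    rw [← mul_assoc]
    exact mul_le_mul_of_nonneg_right hx' (hu0 x').le
  -- the transition densities tilted by `u`
  set g : X → X → ℝ := fun x x' => r y x' x * u x' / v x with hg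
  have hgint : ∀ x, Integrable (g x) μ := fun x => (hru x).div_const _
  have hg0 : ∀ x x', 0 ≤ g x x' := fun x x' =>
    div_nonneg (mul_nonneg (hr.nonneg _ _ _) (hu0 _).le) (hv0 x).le
  have hg1 : ∀ x, ∫ x', g x x' ∂μ = 1 := fun x => by
    rw [hg]
    beta_reduce
    rw [integral_div]
    exact div_self (hv0 x).ne'
  have hgf : ∀ x, Integrable (fun x' => (g x x' : ℂ) * f x') μ := fun x =>
    (hgint x).ofReal.mul_bdd (c := 2 * ‖f p‖) hf.aestronglyMeasurable
      (Eventually.of_forall fun x' => hf2 x')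
  set F : X → ℂ := fun x => ∫ x', (g x x' : ℂ) * f x' ∂μ with hF
  have hFF : ∀ x₁ x₂, ‖F x₁ - F x₂‖ ≤ (1 - κ ^ 2) * (κ ^ 2 / 2 * ‖f p‖) := fun x₁ x₂ => by
    refine norm_average_sub_average_le (hgint x₁) (hgint x₂) (hg0 x₂) (hg1 x₁) (hg1 x₂) (hgf x₁)
      (hgf x₂) ?_ fun x x' => hosc x x' p
    filter_upwards [hr.compare y x₂ x₁] with x' hx'
    have h1 : κ / v x₂ ≤ 1 / v x₁ := by
      rw [div_le_div_iff₀ (hv0 _) (hv0 _), one_mul]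
      exact hv1 _ _
    calc κ ^ 2 * (r y x' x₂ * u x' / v x₂) = (κ * r y x' x₂) * u x' * (κ / v x₂) := by ring
      _ ≤ r y x' x₁ * u x' * (1 / v x₁) := by
          have := hr.nonneg y x' x₁
          have := hr.nonneg y x' x₂
          have := hu0 x'
          have := hv0 x₂
          gcongr
      _ = r y x' x₁ * u x' / v x₁ := by ring
  have hFp : ∀ x, ‖F x - f p‖ ≤ κ ^ 2 / 2 * ‖f p‖ := fun x =>
    norm_average_sub_le (hgint x) (hg0 x) (hg1 x) (hgf x) (f p) fun x' => hosc x' p p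
  have he : ∀ x, ‖f' x - F x‖ ≤ σ * ‖f p‖ := fun x => by
    have hsruf : ∀ x', ‖(s x' x - r y x' x) * (u x' * f x')‖ ≤
        τ * a y * (u p / κ * (2 * ‖f p‖)) := fun x' => by
      rw [norm_mul, norm_mul, Complex.norm_real, Real.norm_of_nonneg (hu0 x').le]
      refine mul_le_mul (hsr x' x) ?_ (mul_nonneg (hu0 x').le (norm_nonneg _)) (hτa x x')
      exact mul_le_mul (hu2 x') (hf2 x') (norm_nonneg _) (by positivity)
    have hrufC : Integrable (fun x' => (r y x' x : ℂ) * (u x' * f x')) μ := by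
      refine ((hgf x).const_mul (v x : ℂ)).congr (Eventually.of_forall fun x' => ?_)
      have : (v x : ℂ) ≠ 0 := by exact_mod_cast (hv0 x).ne'
      simp only [hg]
      push_cast
      field_simp
    have hdiff : Integrable (fun x' => (s x' x - r y x' x) * (u x' * f x')) μ := by
      refine Integrable.of_bound (Measurable.aestronglyMeasurable ?_) _ (Eventually.of_forall hsruf)
      exact ((hs x).sub (Complex.measurable_ofReal.comp (hrm x))).mul
        ((Complex.measurable_ofReal.comp hu).mul hf)
    have h1 : f' x - F x = (∫ x', (s x' x - r y x' x) * (u x' * f x') ∂μ) / (v x : ℂ) := by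
      have h2 : F x = (∫ x', (r y x' x : ℂ) * (u x' * f x') ∂μ) / (v x : ℂ) := by
        rw [← integral_div]
        refine integral_congr_ae (Eventually.of_forall fun x' => ?_)
        simp only [hg]
        push_cast
        ring
      rw [hf', h2, ← sub_div, ← integral_sub ?_ hrufC]
      · simp_rw [sub_mul]
        rfl
      · refine (hdiff.add hrufC).congr (Eventually.of_forall fun x' => ?_)
        simp only [Pi.add_apply]
        ring
    rw [h1, norm_div, Complex.norm_real, Real.norm_of_nonneg (hv0 x).le, div_le_iff₀ (hv0 x)]
    refine (norm_integral_le_of_norm_le_const (Eventually.of_forall hsruf)).trans ?_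
    have hσ0 : 0 ≤ σ := by
      have h2 : 0 ≤ τ := nonneg_of_mul_nonneg_left (hτa x x) ha
      have : 0 ≤ σ * (γ * κ ^ 2) := le_trans (by positivity) hσ
      exact nonneg_of_mul_nonneg_left this (by positivity)
    calc τ * a y * (u p / κ * (2 * ‖f p‖)) * μ.real Set.univ
        = (2 * τ * μ.real Set.univ) * (a y * ‖f p‖ * (u p / κ)) := by ring
      _ ≤ (σ * (γ * κ ^ 2)) * (a y * ‖f p‖ * (u p / κ)) :=
          mul_le_mul_of_nonneg_right hσ (by positivity)
      _ = σ * ‖f p‖ * (γ * a y * (κ * u p)) := by field_simp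
      _ ≤ σ * ‖f p‖ * v x := mul_le_mul_of_nonneg_left (hvp x) (by positivity)
  refine ⟨fun x x' => ?_, fun x => ?_⟩
  · have h1 : f' x - f' x' = (f' x - F x) + (F x - F x') - (f' x' - F x') := by ring
    rw [h1]
    refine (norm_sub_le _ _).trans ?_
    have := norm_add_le (f' x - F x) (F x - F x')
    linarith [he x, he x', hFF x x']
  · have h1 : f p = f' x - (f' x - F x) - (F x - f p) := by ring
    have h2 := norm_sub_le (f' x - (f' x - F x)) (F x - f p)
    have h3 := norm_sub_le (f' x) (f' x - F x)
    rw [← h1] at h2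
    linarith [he x, hFp x]

/-- Iterated integrals of a small complex perturbation of a mixing kernel stay away from zero. How
small the perturbation has to be does not depend on the number of iterations. -/
theorem IsMixingKernel.le_norm_iteratedIntegral (hr : IsMixingKernel μ r a γ κ)
    {s : Y → X → X → ℂ} {τ : ℝ} (hs : Measurable fun z : Y × X × X => s z.1 z.2.1 z.2.2)
    (hsr : ∀ y x' x, ‖s y x' x - r y x' x‖ ≤ τ * a y)
    (hτ : 24 * τ * μ.real Set.univ ≤ γ * κ ^ 6) (n : ℕ) (y : ℕ → Y) (x : X) :
    ∏ k ∈ Finset.range n, (γ / 4 * a (y k)) ≤ ‖iteratedIntegral μ s n y x‖ := by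
  suffices h : ∀ n (y : ℕ → Y),
      (∀ x x' x'', ‖iteratedIntegral μ s n y x / ((iteratedIntegral μ r n y x : ℝ) : ℂ) -
        iteratedIntegral μ s n y x' / ((iteratedIntegral μ r n y x' : ℝ) : ℂ)‖ ≤
        κ ^ 2 / 2 * ‖iteratedIntegral μ s n y x'' / ((iteratedIntegral μ r n y x'' : ℝ) : ℂ)‖) ∧
      ∀ x, (1 / 4) ^ n ≤ ‖iteratedIntegral μ s n y x / ((iteratedIntegral μ r n y x : ℝ) : ℂ)‖ by
    have h1 := (h n y).2 x
    have h2 := hr.iteratedIntegral_pos n y x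
    rw [norm_div, Complex.norm_real, Real.norm_of_nonneg h2.le, le_div_iff₀ h2] at h1
    refine le_trans ?_ h1
    have h3 : ∀ k, γ / 4 * a (y k) = 1 / 4 * (γ * a (y k)) := fun k => by ring
    simp_rw [h3]
    rw [Finset.prod_mul_distrib, Finset.prod_const, Finset.card_range]
    exact mul_le_mul_of_nonneg_left (hr.le_iteratedIntegral n y x) (by positivity)
  intro n
  induction n with
  | zero =>
    intro y
    refine ⟨fun x x' x'' => ?_, fun x => ?_⟩
    · simp only [iteratedIntegral_zero, sub_self, norm_zero]
      positivity
    · simp [iteratedIntegral_zero]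
  | succ n ih =>
    intro y
    obtain ⟨ih1, ih2⟩ := ih fun k => y (k + 1)
    have hpos := hr.iteratedIntegral_pos n fun k => y (k + 1)
    have hstep := hr.perturbed_step (y := y 0) (s := s (y 0)) (σ := κ ^ 4 / 12)
      (fun x => hs.comp (f := fun x' => (y 0, x', x)) (by fun_prop)) (hsr (y 0))
      (measurable_iteratedIntegral_right hr.measurable n fun k => y (k + 1)) hpos
      (hr.compare_iteratedIntegral n _)
      ((measurable_iteratedIntegral_right hs n fun k => y (k + 1)).div
        (Complex.measurable_ofReal.comp
          (measurable_iteratedIntegral_right hr.measurable n fun k => y (k + 1))))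
      (by nlinarith) le_rfl ih1
      (f' := fun x => iteratedIntegral μ s (n + 1) y x / ((iteratedIntegral μ r (n + 1) y x : ℝ) : ℂ))
      (fun x => by
        rw [iteratedIntegral_succ, iteratedIntegral_succ]
        congr 2
        funext x'
        have : ((iteratedIntegral μ r n (fun k => y (k + 1)) x' : ℝ) : ℂ) ≠ 0 := by
          exact_mod_cast (hpos x').ne'
        simp only [Pi.div_apply, Function.comp_apply]
        field_simp)
    refine ⟨hstep.1, fun x => ?_⟩
    refine le_trans ?_ (hstep.2 x x)
    rw [pow_succ, mul_comm]
    exact mul_le_mul_of_nonneg_left (ih2 x) (by norm_num)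

end Perturbation


/-! ### Dependence of iterated integrals on a complex parameter -/

section Parameter

variable {X Y : Type*} [MeasurableSpace X] {μ : Measure X} [IsFiniteMeasure μ]

lemma differentiableOn_integral_of_bounded {U : Set ℂ} (hU : IsOpen U) {F : ℂ → X → ℂ} {M : ℝ}
    (hF : ∀ t ∈ U, Measurable (F t)) (hM : ∀ t ∈ U, ∀ x, ‖F t x‖ ≤ M)
    (hd : ∀ x, DifferentiableOn ℂ (fun t => F t x) U) :
    DifferentiableOn ℂ (fun t => ∫ x, F t x ∂μ) U := by
  intro t₀ ht₀
  obtain ⟨R, hR, hRU⟩ := Metric.isOpen_iff.1 hU t₀ ht₀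
  have hR4 : 0 < R / 4 := by positivity
  have hball : ∀ t ∈ Metric.ball t₀ (R / 4), Metric.closedBall t (R / 4) ⊆ U := by
    intro t ht z hz
    refine hRU ?_
    rw [Metric.mem_ball] at ht ⊢
    rw [Metric.mem_closedBall] at hz
    linarith [dist_triangle z t t₀]
  have hderiv : ∀ x, ∀ t ∈ Metric.ball t₀ (R / 4),
      HasDerivAt (fun t => F t x) (deriv (fun t => F t x) t) t := fun x t ht =>
    ((hd x).differentiableAt (hU.mem_nhds (hball t ht (Metric.mem_closedBall_self hR4.le)))).hasDerivAt
  have hmeas : Measurable fun x => deriv (fun t => F t x) t₀ := by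
    -- the derivative is a limit of difference quotients along a sequence
    obtain ⟨u, -, hu, hu0⟩ := exists_seq_strictAnti_tendsto' hR4
    have hu0' : Tendsto (fun n => t₀ + (u n : ℂ)) atTop (𝓝[≠] t₀) := by
      refine tendsto_nhdsWithin_iff.2 ⟨?_, Eventually.of_forall fun n => ?_⟩
      · have : Tendsto (fun n => t₀ + (u n : ℂ)) atTop (𝓝 (t₀ + ((0 : ℝ) : ℂ))) :=
          tendsto_const_nhds.add ((Complex.continuous_ofReal.tendsto 0).comp hu0)
        simpa using this
      · simpa using (hu n).1.ne'
    refine measurable_of_tendsto_metrizable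
      (f := fun n x => slope (fun t => F t x) t₀ (t₀ + (u n : ℂ))) (fun n => ?_) ?_
    · have h1 : Measurable (F (t₀ + (u n : ℂ))) := by
        refine hF _ (hball t₀ (Metric.mem_ball_self hR4) ?_)
        rw [Metric.mem_closedBall, dist_eq_norm, add_sub_cancel_left, Complex.norm_real,
          Real.norm_of_nonneg (hu n).1.le]
        exact (hu n).2.le
      simp only [slope, vsub_eq_sub, smul_eq_mul]
      exact (h1.sub (hF t₀ ht₀)).const_mul _
    · rw [tendsto_pi_nhds]
      exact fun x => (hderiv x t₀ (Metric.mem_ball_self hR4)).tendsto_slope.comp hu0'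
  refine ((hasDerivAt_integral_of_dominated_loc_of_deriv_le (μ := μ) (F := F)
    (F' := fun t x => deriv (fun t => F t x) t) (bound := fun _ => M / (R / 4))
    (Metric.ball_mem_nhds t₀ hR4) ?_ ?_ hmeas.aestronglyMeasurable ?_ (integrable_const _)
    (Eventually.of_forall hderiv)).2).differentiableAt.differentiableWithinAt
  · filter_upwards [hU.mem_nhds ht₀] with t ht using (hF t ht).aestronglyMeasurable
  · exact Integrable.of_bound (hF t₀ ht₀).aestronglyMeasurable M
      (Eventually.of_forall fun x => hM t₀ ht₀ x)
  · refine Eventually.of_forall fun x t ht => ?_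
    refine Complex.norm_deriv_le_of_forall_mem_sphere_norm_le hR4 ?_ fun z hz =>
      hM z (hball t ht (Metric.sphere_subset_closedBall hz)) x
    exact ((hd x).mono (hball t ht)).diffContOnCl_ball subset_rfl

variable [MeasurableSpace Y] {b : Y → ℝ}

lemma continuousOn_iteratedIntegral {T : Type*} [TopologicalSpace T] [FirstCountableTopology T]
    {V : Set T} {R : T → Y → X → X → ℂ}
    (hmeas : ∀ t ∈ V, Measurable fun z : Y × X × X => R t z.1 z.2.1 z.2.2)
    (hb : ∀ t ∈ V, ∀ y x' x, ‖R t y x' x‖ ≤ b y)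
    (hc : ∀ y x' x, ContinuousOn (fun t => R t y x' x) V) (n : ℕ) (y : ℕ → Y) (x : X) :
    ContinuousOn (fun t => iteratedIntegral μ (R t) n y x) V := by
  induction n generalizing y x with
  | zero => exact continuousOn_const
  | succ n ih =>
    simp only [iteratedIntegral_succ]
    refine continuousOn_of_dominated (bound := fun _ =>
      b (y 0) * ∏ k ∈ Finset.range n, (μ.real Set.univ * b (y (k + 1)))) (fun t ht => ?_)
      (fun t ht => Eventually.of_forall fun x' => ?_) (integrable_const _)
      (Eventually.of_forall fun x' => (hc _ _ _).mul (ih _ _))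
    · exact (integrable_mul_iteratedIntegral (hmeas t ht) (hb t ht) _ _ _ _).aestronglyMeasurable
    · rw [norm_mul]
      exact mul_le_mul (hb t ht _ _ _) (norm_iteratedIntegral_le (hb t ht) _ _ _) (norm_nonneg _)
        ((norm_nonneg _).trans (hb t ht _ x x))

lemma differentiableOn_iteratedIntegral {V : Set ℂ} (hV : IsOpen V) {R : ℂ → Y → X → X → ℂ}
    (hmeas : ∀ t ∈ V, Measurable fun z : Y × X × X => R t z.1 z.2.1 z.2.2)
    (hb : ∀ t ∈ V, ∀ y x' x, ‖R t y x' x‖ ≤ b y)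
    (hc : ∀ y x' x, DifferentiableOn ℂ (fun t => R t y x' x) V) (n : ℕ) (y : ℕ → Y) (x : X) :
    DifferentiableOn ℂ (fun t => iteratedIntegral μ (R t) n y x) V := by
  induction n generalizing y x with
  | zero => exact differentiableOn_const _
  | succ n ih =>
    simp only [iteratedIntegral_succ]
    refine differentiableOn_integral_of_bounded hV
      (M := b (y 0) * ∏ k ∈ Finset.range n, (μ.real Set.univ * b (y (k + 1))))
      (fun t ht => ?_) (fun t ht x' => ?_) fun x' => (hc _ _ _).mul (ih _ _)
    · exact ((hmeas t ht).comp (f := fun x' => (y 0, x', x)) (by fun_prop)).mul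
        (measurable_iteratedIntegral_right (hmeas t ht) n _)
    · rw [norm_mul]
      exact mul_le_mul (hb t ht _ _ _) (norm_iteratedIntegral_le (hb t ht) _ _ _) (norm_nonneg _)
        ((norm_nonneg _).trans (hb t ht _ x x))

end Parameter

/-! ### The candidate model -/

section Candidate

variable {d : ℕ} {X Y : Type*} [MeasurableSpace X] [MeasurableSpace Y]
  {μ : Measure X} {ν : Measure Y} {Θ : Set (EuclideanSpace ℝ (Fin d))}
  {p : EuclideanSpace ℝ (Fin d) → X → X → ℝ} {q : EuclideanSpace ℝ (Fin d) → Y → X → ℝ}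
  {δ : ℝ} {rhat : EuclideanSpace ℂ (Fin d) → Y → X → X → ℂ}
  {vphi : EuclideanSpace ℂ (Fin d) → Y → ℂ} {phi psi : Y → ℝ}

lemma ball_subset_vicinity {θ : EuclideanSpace ℝ (Fin d)} (hθ : θ ∈ Θ) :
    Metric.ball (toComplexVec θ) δ ⊆ vicinity δ Θ :=
  fun _ hη => ⟨θ, hθ, mem_ball_iff_norm.1 hη⟩

lemma AnalyticityCondition.toComplexVec_mem
    (h : AnalyticityCondition ν Θ p q δ rhat vphi phi psi) {θ : EuclideanSpace ℝ (Fin d)}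
    (hθ : θ ∈ Θ) : toComplexVec θ ∈ vicinity δ Θ :=
  ball_subset_vicinity hθ (Metric.mem_ball_self h.delta_pos)

lemma measurable_transDensity (hpq : IsDensityFamily μ ν Θ p q) {θ : EuclideanSpace ℝ (Fin d)}
    (hθ : θ ∈ Θ) : Measurable fun z : Y × X × X => transDensity p q θ z.1 z.2.1 z.2.2 :=
  ((hpq.measurable_q θ hθ).comp (f := fun z : Y × X × X => (z.1, z.2.1)) (by fun_prop)).mul
    ((hpq.measurable_p θ hθ).comp (f := fun z : Y × X × X => (z.2.1, z.2.2)) (by fun_prop))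

lemma transDensity_nonneg (hpq : IsDensityFamily μ ν Θ p q) {θ : EuclideanSpace ℝ (Fin d)}
    (hθ : θ ∈ Θ) (y : Y) (x' x : X) : 0 ≤ transDensity p q θ y x' x :=
  mul_nonneg (hpq.q_nonneg θ hθ _ _) (hpq.p_nonneg θ hθ _ _)

/-- The mixing condition bounds the measures `r_θ(y,x'|x) μ(dx')`; as these have densities, it compares
the densities almost everywhere, with the factor `ε²`. -/
theorem exists_isMixingKernel_transDensity [IsFiniteMeasure μ] (hpq : IsDensityFamily μ ν Θ p q)
    (hmix : MixingCondition μ Θ p q) (h : AnalyticityCondition ν Θ p q δ rhat vphi phi psi)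
    (hlower : LowerBoundCondition μ Θ p q vphi) :
    ∃ γ κ : ℝ, ∀ θ ∈ Θ,
      IsMixingKernel μ (transDensity p q θ) (fun y => ‖vphi (toComplexVec θ) y‖) γ κ := by
  obtain ⟨γ, hγ0, -, hγ⟩ := hlower
  obtain ⟨ε, hε0, hε1, hε⟩ := hmix
  refine ⟨γ, ε ^ 2, fun θ hθ => ?_⟩
  have hmeas := measurable_transDensity hpq hθ
  have hmeas1 : ∀ y x, Measurable fun x' => transDensity p q θ y x' x := fun y x =>
    hmeas.comp (f := fun x' => (y, x', x)) (by fun_prop)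
  have hnn := transDensity_nonneg hpq hθ
  have hle : ∀ y x' x, transDensity p q θ y x' x ≤ ‖vphi (toComplexVec θ) y‖ := fun y x' x => by
    have h1 := h.rhat_le _ (h.toComplexVec_mem hθ) y x' x
    rw [h.rhat_eq θ hθ, Complex.norm_real] at h1
    exact (le_abs_self _).trans h1
  refine ⟨hmeas, hγ0, by positivity, pow_le_one₀ hε0.le hε1.le,
    fun y => norm_pos_iff.2 (h.vphi_ne_zero _ (h.toComplexVec_mem hθ) y), hnn, hle,
    fun y x => ?_, fun y x₁ x₂ => ?_⟩
  · have hint : Integrable (fun x' => transDensity p q θ y x' x) μ :=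
      Integrable.of_bound (C := ‖vphi (toComplexVec θ) y‖) (hmeas1 y x).aestronglyMeasurable
        (Eventually.of_forall fun x' => by
          rw [Real.norm_of_nonneg (hnn _ _ _)]
          exact hle _ _ _)
    have h1 := hγ θ hθ x y
    rw [← ofReal_integral_eq_lintegral_ofReal hint (Eventually.of_forall fun x' => hnn _ _ _)] at h1
    exact (ENNReal.ofReal_le_ofReal_iff (integral_nonneg fun x' => hnn _ _ _)).1 h1
  · obtain ⟨lam, hlam, hB⟩ := hε θ hθ y
    have h1 : (fun x' => ENNReal.ofReal (ε ^ 2 * transDensity p q θ y x' x₁)) ≤ᵐ[μ]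
        fun x' => ENNReal.ofReal (transDensity p q θ y x' x₂) := by
      refine ae_le_of_forall_setLIntegral_le_of_sigmaFinite ?_ fun s hs _ => ?_
      · exact ((hmeas1 y x₁).const_mul _).ennreal_ofReal
      · have e : ENNReal.ofReal ε ≠ 0 := by simpa using hε0
        calc ∫⁻ x' in s, ENNReal.ofReal (ε ^ 2 * transDensity p q θ y x' x₁) ∂μ
            = ENNReal.ofReal (ε ^ 2) * ∫⁻ x' in s, ENNReal.ofReal (transDensity p q θ y x' x₁) ∂μ := by
              simp_rw [ENNReal.ofReal_mul (sq_nonneg ε)]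
              exact lintegral_const_mul _ (hmeas1 y x₁).ennreal_ofReal
          _ ≤ ENNReal.ofReal (ε ^ 2) * (lam s / ENNReal.ofReal ε) := by
              gcongr
              exact (hB x₁ s hs).2
          _ = ENNReal.ofReal ε * lam s := by
              rw [ENNReal.ofReal_pow hε0.le, sq, mul_assoc,
                ENNReal.mul_div_cancel e ENNReal.ofReal_ne_top]
          _ ≤ _ := (hB x₂ s hs).1
    filter_upwards [h1] with x' hx'
    exact (ENNReal.ofReal_le_ofReal_iff (hnn _ _ _)).1 hx'

lemma lintegral_pi_prod_eq [IsFiniteMeasure μ] {r : Y → X → X → ℝ} {a : Y → ℝ} {γ κ : ℝ}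
    (hr : IsMixingKernel μ r a γ κ) (n : ℕ) (y : ℕ → Y) (x₀ : X) :
    ∫⁻ x : Fin n → X, ∏ k : Fin n, ENNReal.ofReal (r (y k)
      ((Fin.cons x₀ x : Fin (n + 1) → X) k.succ) ((Fin.cons x₀ x : Fin (n + 1) → X) k.castSucc))
      ∂(Measure.pi fun _ => μ) = ENNReal.ofReal (iteratedIntegral μ r n y x₀) := by
  induction n generalizing y x₀ with
  | zero => simp [iteratedIntegral_zero]
  | succ n ih =>
    have hprod : ∀ (m : ℕ) (y : ℕ → Y), Measurable fun z : X × (Fin m → X) =>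
        ∏ k : Fin m, ENNReal.ofReal (r (y k)
          ((Fin.cons z.1 z.2 : Fin (m + 1) → X) k.succ)
          ((Fin.cons z.1 z.2 : Fin (m + 1) → X) k.castSucc)) := by
      intro m y
      have hc : Measurable fun z : X × (Fin m → X) => (Fin.cons z.1 z.2 : Fin (m + 1) → X) := by
        refine measurable_pi_iff.2 fun i => ?_
        refine Fin.cases ?_ (fun j => ?_) i
        · simpa using measurable_fst
        · simpa using measurable_pi_iff.1 measurable_snd j
      refine Finset.measurable_fun_prod _ fun k _ => ENNReal.measurable_ofReal.comp ?_
      exact hr.measurable.comp (measurable_const.prodMk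
        (((measurable_pi_apply k.succ).comp hc).prodMk ((measurable_pi_apply k.castSucc).comp hc)))
    rw [← ((measurePreserving_piFinSuccAbove (fun _ : Fin (n + 1) => μ) 0).symm).lintegral_comp_emb
      (MeasurableEquiv.measurableEmbedding _)]
    simp_rw [MeasurableEquiv.piFinSuccAbove_symm_apply, Fin.insertNthEquiv, Equiv.coe_fn_mk,
      Fin.insertNth_zero, cast_eq, Fin.prod_univ_succ]
    simp only [Fin.castSucc_zero, ← Fin.succ_castSucc, Fin.cons_succ, Fin.cons_zero, Fin.val_zero,
      Fin.val_succ]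
    have hmr : Measurable fun x' => ENNReal.ofReal (r (y 0) x' x₀) :=
      (hr.measurable.comp (f := fun x' => (y 0, x', x₀)) (by fun_prop)).ennreal_ofReal
    change ∫⁻ z : X × (Fin n → X), ENNReal.ofReal (r (y 0) z.1 x₀) *
      ∏ k : Fin n, ENNReal.ofReal (r (y (k + 1)) ((Fin.cons z.1 z.2 : Fin (n + 1) → X) k.succ)
        ((Fin.cons z.1 z.2 : Fin (n + 1) → X) k.castSucc)) ∂(μ.prod (Measure.pi fun _ => μ)) = _
    rw [lintegral_prod (fun z : X × (Fin n → X) => ENNReal.ofReal (r (y 0) z.1 x₀) *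
      ∏ k : Fin n, ENNReal.ofReal (r (y (k + 1)) ((Fin.cons z.1 z.2 : Fin (n + 1) → X) k.succ)
        ((Fin.cons z.1 z.2 : Fin (n + 1) → X) k.castSucc))) (Measurable.aemeasurable
      ((hmr.comp measurable_fst).mul (hprod n fun k => y (k + 1))))]
    have hin : ∀ x' : X, ∫⁻ x : Fin n → X, ENNReal.ofReal (r (y 0) x' x₀) *
        ∏ k : Fin n, ENNReal.ofReal (r (y (k + 1))
          ((Fin.cons x' x : Fin (n + 1) → X) k.succ) ((Fin.cons x' x : Fin (n + 1) → X) k.castSucc))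
        ∂(Measure.pi fun _ => μ) =
        ENNReal.ofReal (r (y 0) x' x₀ * iteratedIntegral μ r n (fun k => y (k + 1)) x') := by
      intro x'
      rw [lintegral_const_mul' _ _ ENNReal.ofReal_ne_top, ih (fun k => y (k + 1)) x',
        ENNReal.ofReal_mul (hr.nonneg _ _ _)]
    refine (lintegral_congr hin).trans ?_
    rw [iteratedIntegral_succ, ofReal_integral_eq_lintegral_ofReal
      (integrable_mul_iteratedIntegral hr.measurable hr.norm_le _ _ _ _)
      (Eventually.of_forall fun x' =>
        mul_nonneg (hr.nonneg _ _ _) (hr.iteratedIntegral_pos _ _ _).le)]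

lemma obsDensity_eq_lintegral [IsFiniteMeasure μ] {θ : EuclideanSpace ℝ (Fin d)} {a : Y → ℝ}
    {γ κ : ℝ} (hr : IsMixingKernel μ (transDensity p q θ) a γ κ) (lam : Measure X) (n : ℕ)
    (y : ℕ → Y) :
    obsDensity μ p q θ lam n (fun k => y k) =
      ∫⁻ x₀, ENNReal.ofReal (iteratedIntegral μ (transDensity p q θ) n y x₀) ∂lam :=
  lintegral_congr fun x₀ => lintegral_pi_prod_eq hr n y x₀

/-- On a complex ball whose radius does not depend on `n`, the iterated integrals of the complex
continuation stay away from zero. -/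
theorem exists_ball_le_norm_iteratedIntegral [IsFiniteMeasure μ]
    (h : AnalyticityCondition ν Θ p q δ rhat vphi phi psi) {θ : EuclideanSpace ℝ (Fin d)}
    (hθ : θ ∈ Θ) {γ κ : ℝ}
    (hr : IsMixingKernel μ (transDensity p q θ) (fun y => ‖vphi (toComplexVec θ) y‖) γ κ) :
    ∃ R > 0, R ≤ δ ∧ ∀ η ∈ Metric.ball (toComplexVec θ) R, ∀ (n : ℕ) (y : ℕ → Y) (x : X),
      ∏ k ∈ Finset.range n, (γ / 4 * ‖vphi η (y k)‖) ≤ ‖iteratedIntegral μ (rhat η) n y x‖ := by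
  have hδ := h.delta_pos
  have hγ := hr.gamma_pos
  have hκ := hr.kappa_pos
  set R₀ : ℝ := δ * (γ * κ ^ 6) / (48 * (μ.real Set.univ + 1)) with hR₀
  have hμ : 0 ≤ μ.real Set.univ := measureReal_nonneg
  have hR₀pos : 0 < R₀ := by positivity
  refine ⟨min R₀ δ, lt_min hR₀pos hδ, min_le_right _ _, fun η hη n y x => ?_⟩
  have hηδ : η ∈ Metric.ball (toComplexVec θ) δ := Metric.ball_subset_ball (min_le_right _ _) hη
  have hηV := ball_subset_vicinity hθ hηδ
  have hθV := h.toComplexVec_mem hθ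
  -- the continuation normalized so as to be real at the centre
  let s : Y → X → X → ℂ := fun y x' x => vphi (toComplexVec θ) y / vphi η y * rhat η y x' x
  have hs : Measurable fun z : Y × X × X => s z.1 z.2.1 z.2.2 :=
    (((h.vphi_measurable _ hθV).comp measurable_fst).div
      ((h.vphi_measurable _ hηV).comp measurable_fst)).mul (h.rhat_measurable _ hηV)
  have hsr : ∀ y x' x, ‖s y x' x - transDensity p q θ y x' x‖ ≤
      (2 / δ * R₀) * ‖vphi (toComplexVec θ) y‖ := by
    intro y x' x
    let G : EuclideanSpace ℂ (Fin d) → ℂ := fun η => rhat η y x' x / vphi η y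
    have hG1 : ∀ η ∈ vicinity δ Θ, ‖G η‖ ≤ 1 := fun η hη => by
      rw [norm_div, div_le_one (norm_pos_iff.2 (h.vphi_ne_zero η hη y))]
      exact h.rhat_le η hη y x' x
    have hGd : DifferentiableOn ℂ G (Metric.ball (toComplexVec θ) δ) := fun η hη =>
      (((h.rhat_analytic y x' x η (ball_subset_vicinity hθ hη)).div
        (h.vphi_analytic y η (ball_subset_vicinity hθ hη))
        (h.vphi_ne_zero η (ball_subset_vicinity hθ hη) y)).differentiableAt).differentiableWithinAt
    have hG := Complex.dist_le_div_mul_dist_of_mapsTo_ball (R₂ := 2) hGd (fun η hη => by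
      rw [mem_closedBall_iff_norm]
      have := norm_sub_le (G η) (G (toComplexVec θ))
      linarith [hG1 η (ball_subset_vicinity hθ hη), hG1 _ hθV]) hηδ
    have e : s y x' x - transDensity p q θ y x' x =
        vphi (toComplexVec θ) y * (G η - G (toComplexVec θ)) := by
      have h1 := h.vphi_ne_zero _ hηV y
      have h2 := h.vphi_ne_zero _ hθV y
      simp only [s, G, ← h.rhat_eq θ hθ]
      field_simp
    rw [e, norm_mul, mul_comm, ← dist_eq_norm]
    refine mul_le_mul_of_nonneg_right (hG.trans ?_) (norm_nonneg _)
    exact mul_le_mul_of_nonneg_left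
      ((Metric.mem_ball.1 hη).le.trans (min_le_left _ _)) (by positivity)
  have hmain := hr.le_norm_iteratedIntegral hs hsr (by
    have e : 24 * (2 / δ * R₀) * μ.real Set.univ =
        γ * κ ^ 6 * (μ.real Set.univ / (μ.real Set.univ + 1)) := by
      rw [hR₀]
      field_simp
      ring
    rw [e]
    refine mul_le_of_le_one_right (by positivity) ((div_le_one (by positivity)).2 (by linarith))) n y x
  rw [iteratedIntegral_mul_left, norm_mul, norm_prod] at hmain
  have hpos : 0 < ∏ k ∈ Finset.range n, ‖vphi (toComplexVec θ) (y k) / vphi η (y k)‖ :=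
    Finset.prod_pos fun k _ =>
      norm_pos_iff.2 (div_ne_zero (h.vphi_ne_zero _ hθV _) (h.vphi_ne_zero _ hηV _))
  refine le_of_mul_le_mul_left (le_trans (le_of_eq ?_) hmain) hpos
  rw [← Finset.prod_mul_distrib]
  refine Finset.prod_congr rfl fun k _ => ?_
  have h1 := norm_pos_iff.2 (h.vphi_ne_zero _ hηV (y k))
  rw [norm_div]
  field_simp

/-- The constant in the linear bound on the log-likelihood. -/
def logBound (μ : Measure X) (γ : ℝ) : ℝ := |Real.log (μ.real Set.univ)| + |Real.log (γ / 4)|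

lemma abs_log_le_of_prod_bounds {γ v : ℝ} (hγ : 0 < γ) (hμ : 0 < μ.real Set.univ) {n : ℕ}
    {b t : ℕ → ℝ} (hb : ∀ k, 0 < b k) (ht : ∀ k, |Real.log (b k)| ≤ t k)
    (h1 : ∏ k ∈ Finset.range n, (γ / 4 * b k) ≤ v)
    (h2 : v ≤ ∏ k ∈ Finset.range n, (μ.real Set.univ * b k)) :
    |Real.log v| ≤ ∑ k ∈ Finset.range n, (t k + logBound μ γ) := by
  have hpos : 0 < ∏ k ∈ Finset.range n, (γ / 4 * b k) :=
    Finset.prod_pos fun k _ => mul_pos (by positivity) (hb k)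
  have h3 := Real.log_le_log hpos h1
  have h4 := Real.log_le_log (hpos.trans_le h1) h2
  rw [Real.log_prod fun k _ => (mul_pos (by positivity) (hb k)).ne'] at h3 h4
  have e1 : ∀ k, Real.log (γ / 4 * b k) = Real.log (γ / 4) + Real.log (b k) := fun k =>
    Real.log_mul (by positivity) (hb k).ne'
  have e2 : ∀ k, Real.log (μ.real Set.univ * b k) = Real.log (μ.real Set.univ) + Real.log (b k) :=
    fun k => Real.log_mul hμ.ne' (hb k).ne'
  simp_rw [e1] at h3
  simp_rw [e2] at h4
  rw [abs_le, ← Finset.sum_neg_distrib]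
  constructor
  · refine le_trans (Finset.sum_le_sum fun k _ => ?_) h3
    have := abs_le.1 (ht k)
    have := neg_abs_le (Real.log (γ / 4))
    have := abs_nonneg (Real.log (μ.real Set.univ))
    simp only [logBound]
    linarith
  · refine le_trans h4 (Finset.sum_le_sum fun k _ => ?_)
    have := abs_le.1 (ht k)
    have := le_abs_self (Real.log (μ.real Set.univ))
    have := abs_nonneg (Real.log (γ / 4))
    simp only [logBound]
    linarith

lemma IsMixingKernel.measure_pos [IsFiniteMeasure μ] {r : Y → X → X → ℝ} {a : Y → ℝ} {γ κ : ℝ}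
    (hr : IsMixingKernel μ r a γ κ) (y : Y) (x : X) : 0 < μ.real Set.univ := by
  have h1 := hr.lower y x
  have h2 : ∫ x', r y x' x ∂μ ≤ a y * μ.real Set.univ :=
    (le_abs_self _).trans (norm_integral_le_of_norm_le_const
      (Eventually.of_forall fun x' => hr.norm_le y x' x))
  exact pos_of_mul_pos_right ((mul_pos hr.gamma_pos (hr.bound_pos y)).trans_le (h1.trans h2))
    (hr.bound_pos y).le

end Candidate


/-! ### The true model -/

/-- Closeness of two probability measures on all measurable sets gives closeness of the integrals of
bounded functions, by the layer-cake formula. -/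
lemma abs_integral_sub_integral_le {S : Type*} [MeasurableSpace S] {ν₁ ν₂ : Measure S}
    [IsProbabilityMeasure ν₁] [IsProbabilityMeasure ν₂] {G : S → ℝ} (hG : Measurable G) {M e : ℝ}
    (hM : ∀ s, |G s| ≤ M) (he : ∀ B, MeasurableSet B → |ν₁.real B - ν₂.real B| ≤ e) :
    |∫ s, G s ∂ν₁ - ∫ s, G s ∂ν₂| ≤ 2 * M * e := by
  have hM0 : 0 ≤ M := by
    obtain ⟨s⟩ : Nonempty S := nonempty_of_isProbabilityMeasure ν₁
    exact (abs_nonneg _).trans (hM s)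
  have hb : ∀ s, 0 ≤ G s + M ∧ G s + M ≤ 2 * M := fun s => by
    have := abs_le.1 (hM s)
    constructor <;> linarith
  have hGi : ∀ (ν : Measure S) [IsProbabilityMeasure ν], Integrable G ν := fun ν _ =>
    Integrable.of_bound hG.aestronglyMeasurable M (Eventually.of_forall hM)
  have key : ∀ (ν : Measure S) [IsProbabilityMeasure ν],
      ∫ s, G s ∂ν = (∫ t in Set.Ioc 0 (2 * M), ν.real {s | t ≤ G s + M}) - M := fun ν _ => by
    have hi : Integrable (fun s => G s + M) ν := (hGi ν).add (integrable_const M)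
    rw [← hi.integral_eq_integral_Ioc_meas_le (Eventually.of_forall fun s => (hb s).1)
      (Eventually.of_forall fun s => (hb s).2), integral_add (hGi ν) (integrable_const M)]
    simp
  have hint : ∀ (ν : Measure S) [IsProbabilityMeasure ν],
      IntegrableOn (fun t => ν.real {s | t ≤ G s + M}) (Set.Ioc 0 (2 * M)) := fun ν _ => by
    have hanti : Antitone fun t => ν.real {s | t ≤ G s + M} := fun t t' htt' =>
      measureReal_mono fun s hs => htt'.trans hs
    refine Integrable.of_bound hanti.measurable.aestronglyMeasurable 1
      (Eventually.of_forall fun t => ?_)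
    rw [Real.norm_of_nonneg measureReal_nonneg]
    exact measureReal_le_one
  rw [key ν₁, key ν₂, sub_sub_sub_cancel_right, ← integral_sub (hint ν₁) (hint ν₂)]
  have := norm_setIntegral_le_of_norm_le_const (μ := volume) (s := Set.Ioc 0 (2 * M)) (C := e)
    (f := fun t => ν₁.real {s | t ≤ G s + M} - ν₂.real {s | t ≤ G s + M}) measure_Ioc_lt_top
    fun t _ => he _ (measurableSet_le measurable_const (hG.add_const M))
  rw [Real.norm_eq_abs] at this
  refine this.trans (le_of_eq ?_)
  rw [measureReal_def, Real.volume_Ioc, sub_zero, ENNReal.toReal_ofReal (by positivity)]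
  ring

section TrueModel

variable {X Y Ω : Type*} [MeasurableSpace X] [MeasurableSpace Y] [MeasurableSpace Ω]
  {Pr : Measure Ω} {P : Kernel X X} {Q : Kernel X Y} {Xst : ℕ → Ω → X} {Yobs : ℕ → Ω → Y}

/-- The conditional law of the next state and observation, given the current state. -/
def stepKernel (P : Kernel X X) (Q : Kernel X Y) : Kernel X (X × Y) :=
  P ⊗ₖ Kernel.prodMkLeft X Q

instance isMarkovKernel_stepKernel [IsMarkovKernel P] [IsMarkovKernel Q] :
    IsMarkovKernel (stepKernel P Q) := by
  unfold stepKernel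
  infer_instance

/-- The states and observations up to time `n`. -/
def history (Xst : ℕ → Ω → X) (Yobs : ℕ → Ω → Y) (n : ℕ) (ω : Ω) : Fin (n + 1) → X × Y :=
  fun k => (Xst k ω, Yobs k ω)

namespace IsHiddenMarkovModel

lemma measurable_pair (h : IsHiddenMarkovModel Pr P Q Xst Yobs) (n : ℕ) :
    Measurable fun ω => (Xst n ω, Yobs n ω) :=
  (h.measurable_state n).prodMk (h.measurable_obs n)

lemma measurable_history (h : IsHiddenMarkovModel Pr P Q Xst Yobs) (n : ℕ) :
    Measurable (history Xst Yobs n) :=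
  measurable_pi_iff.2 fun k => h.measurable_pair k

/-- The kernel of the next step as a function of the whole history. -/
def historyKernel (P : Kernel X X) (Q : Kernel X Y) (n : ℕ) :
    Kernel (Fin (n + 1) → X × Y) (X × Y) :=
  (stepKernel P Q).comap (fun w => (w (Fin.last n)).1) (by fun_prop)

variable [IsProbabilityMeasure Pr] [IsMarkovKernel P] [IsMarkovKernel Q]

instance isMarkovKernel_historyKernel (n : ℕ) : IsMarkovKernel (historyKernel P Q n) := by
  unfold historyKernel
  infer_instance

/-- The joint law of the history up to time `n` and of the next state and observation. -/
theorem map_history_eq (h : IsHiddenMarkovModel Pr P Q Xst Yobs) (n : ℕ) :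
    Pr.map (fun ω => (history Xst Yobs n ω, (Xst (n + 1) ω, Yobs (n + 1) ω))) =
      (Pr.map (history Xst Yobs n)) ⊗ₘ historyKernel P Q n := by
  have hh := h.measurable_history n
  have hp := h.measurable_pair (n + 1)
  have := Measure.isProbabilityMeasure_map (μ := Pr) (hh.prodMk hp).aemeasurable
  have := Measure.isProbabilityMeasure_map (μ := Pr) hh.aemeasurable
  refine Measure.ext_prod fun {s t} hs ht => ?_
  rw [Measure.map_apply (hh.prodMk hp) (hs.prod ht), Measure.compProd_apply_prod hs ht,
    setLIntegral_map hs ((historyKernel P Q n).measurable_coe ht) hh]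
  have hm : MeasurableSpace.comap (history Xst Yobs n) inferInstance ≤ ‹MeasurableSpace Ω› :=
    hh.comap_le
  have hs' : MeasurableSet[MeasurableSpace.comap (history Xst Yobs n) inferInstance]
      (history Xst Yobs n ⁻¹' s) := ⟨s, hs, rfl⟩
  have hI : Integrable (((fun ω => (Xst (n + 1) ω, Yobs (n + 1) ω)) ⁻¹' t).indicator
      fun _ => (1 : ℝ)) Pr := (integrable_const 1).indicator (hp ht)
  have h1 := setIntegral_condExp hm hI hs'
  rw [setIntegral_congr_ae (g := fun ω => (historyKernel P Q n (history Xst Yobs n ω) t).toReal)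
      (hh hs) ?_, setIntegral_indicator (hp ht), setIntegral_const, smul_eq_mul, mul_one,
      integral_toReal ?_ (Eventually.of_forall fun ω => measure_lt_top _ _), measureReal_def,
      ENNReal.toReal_eq_toReal_iff' ?_ (measure_ne_top _ _)] at h1
  · rw [h1]
    rfl
  · refine ((lintegral_mono fun ω => prob_le_one).trans_lt ?_).ne
    simp
  · exact ((Kernel.measurable_coe _ ht).comp hh).aemeasurable
  · filter_upwards [h.condExp_eq n t ht] with ω hω _
    refine hω.trans ?_
    rw [historyKernel, Kernel.comap_apply, stepKernel, Kernel.compProd_apply ht]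
    rfl

lemma lintegral_history (h : IsHiddenMarkovModel Pr P Q Xst Yobs) (n : ℕ)
    {F : (Fin (n + 1) → X × Y) × (X × Y) → ℝ≥0∞} (hF : Measurable F) :
    ∫⁻ ω, F (history Xst Yobs n ω, (Xst (n + 1) ω, Yobs (n + 1) ω)) ∂Pr =
      ∫⁻ ω, ∫⁻ z, F (history Xst Yobs n ω, z) ∂(stepKernel P Q (Xst n ω)) ∂Pr := by
  have hh := h.measurable_history n
  have := Measure.isProbabilityMeasure_map (μ := Pr) hh.aemeasurable
  rw [← lintegral_map hF (hh.prodMk (h.measurable_pair (n + 1))), h.map_history_eq n,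
    Measure.lintegral_compProd hF, lintegral_map hF.lintegral_kernel_prod_right' hh]
  rfl

lemma integral_history (h : IsHiddenMarkovModel Pr P Q Xst Yobs) (n : ℕ)
    {F : (Fin (n + 1) → X × Y) × (X × Y) → ℝ} (hF : Measurable F)
    (hint : Integrable (fun ω => F (history Xst Yobs n ω, (Xst (n + 1) ω, Yobs (n + 1) ω))) Pr) :
    ∫ ω, F (history Xst Yobs n ω, (Xst (n + 1) ω, Yobs (n + 1) ω)) ∂Pr =
      ∫ ω, ∫ z, F (history Xst Yobs n ω, z) ∂(stepKernel P Q (Xst n ω)) ∂Pr := by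
  have hh := h.measurable_history n
  have hhp := hh.prodMk (h.measurable_pair (n + 1))
  have := Measure.isProbabilityMeasure_map (μ := Pr) hh.aemeasurable
  rw [← integral_map hhp.aemeasurable (f := F) hF.aestronglyMeasurable, h.map_history_eq n,
    Measure.integral_compProd, integral_map hh.aemeasurable]
  · rfl
  · exact hF.stronglyMeasurable.integral_kernel_prod_right'.aestronglyMeasurable
  · rw [← h.map_history_eq n]
    exact (integrable_map_measure hF.aestronglyMeasurable hhp.aemeasurable).2 hint

lemma map_state_succ (h : IsHiddenMarkovModel Pr P Q Xst Yobs) (n : ℕ) :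
    Pr.map (Xst (n + 1)) = P ∘ₘ Pr.map (Xst n) := by
  ext B hB
  rw [Measure.bind_apply hB P.aemeasurable, lintegral_map (P.measurable_coe hB) (h.measurable_state n),
    ← lintegral_indicator_one hB, lintegral_map (measurable_one.indicator hB) (h.measurable_state _)]
  rw [h.lintegral_history n (F := fun w => B.indicator 1 w.2.1)
    ((measurable_one.indicator hB).comp (by fun_prop))]
  refine lintegral_congr fun ω => ?_
  rw [stepKernel, Kernel.lintegral_compProd _ _ _ (f := fun z : X × Y => B.indicator 1 z.1)
    ((measurable_one.indicator hB).comp measurable_fst)]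
  simp [lintegral_indicator_one hB]

lemma map_state (h : IsHiddenMarkovModel Pr P Q Xst Yobs) (n : ℕ) :
    Pr.map (Xst n) = (P ^ n) ∘ₘ Pr.map (Xst 0) := by
  induction n with
  | zero => exact (Measure.id_comp).symm
  | succ n ih => rw [h.map_state_succ, ih, Measure.comp_assoc, pow_succ']; rfl

lemma isMarkovKernel_pow (n : ℕ) : IsMarkovKernel (P ^ n) := by
  induction n with
  | zero => exact inferInstanceAs (IsMarkovKernel Kernel.id)
  | succ n ih =>
    rw [pow_succ]
    exact inferInstanceAs (IsMarkovKernel ((P ^ n) ∘ₖ P))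

lemma abs_law_state_sub_le (h : IsHiddenMarkovModel Pr P Q Xst Yobs) {π : Measure X} {e : ℝ} {n : ℕ}
    (he : ∀ x B, MeasurableSet B → |((P ^ n) x).real B - π.real B| ≤ e) {B : Set X}
    (hB : MeasurableSet B) : |(Pr.map (Xst n)).real B - π.real B| ≤ e := by
  have := isMarkovKernel_pow (P := P) n
  have := Measure.isProbabilityMeasure_map (μ := Pr) (h.measurable_state 0).aemeasurable
  have hm : Measurable fun x => (((P ^ n) x) B).toReal := ((P ^ n).measurable_coe hB).ennreal_toReal
  have hint : Integrable (fun x => ((P ^ n) x).real B) (Pr.map (Xst 0)) :=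
    Integrable.of_bound hm.aestronglyMeasurable 1 (Eventually.of_forall fun x => by
      rw [Real.norm_of_nonneg measureReal_nonneg]
      exact measureReal_le_one)
  have h1 : (Pr.map (Xst n)).real B = ∫ x, ((P ^ n) x).real B ∂(Pr.map (Xst 0)) := by
    rw [h.map_state n, measureReal_def, Measure.bind_apply hB (P ^ n).aemeasurable]
    exact (integral_toReal ((P ^ n).measurable_coe hB).aemeasurable
      (Eventually.of_forall fun x => measure_lt_top _ _)).symm
  have h2 : (Pr.map (Xst n)).real B - π.real B =
      ∫ x, (((P ^ n) x).real B - π.real B) ∂(Pr.map (Xst 0)) := by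
    rw [h1, integral_sub hint (integrable_const _)]
    simp
  rw [h2]
  have := norm_integral_le_of_norm_le_const (μ := Pr.map (Xst 0)) (C := e)
    (f := fun x => ((P ^ n) x).real B - π.real B) (Eventually.of_forall fun x => he x B hB)
  simpa using this

end IsHiddenMarkovModel

end TrueModel


section TrueModel

variable {X Y Ω : Type*} [MeasurableSpace X] [MeasurableSpace Y] [MeasurableSpace Ω]
  {Pr : Measure Ω} {P : Kernel X X} {Q : Kernel X Y} {Xst : ℕ → Ω → X} {Yobs : ℕ → Ω → Y}
  {psi : Y → ℝ} {K : ℝ}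

/-- The states and observations at the times `j, …, j + m`. -/
def block (Xst : ℕ → Ω → X) (Yobs : ℕ → Ω → Y) (j m : ℕ) (ω : Ω) : Fin (m + 1) → X × Y :=
  fun k => (Xst (j + k) ω, Yobs (j + k) ω)

lemma IsHiddenMarkovModel.measurable_block (h : IsHiddenMarkovModel Pr P Q Xst Yobs) (j m : ℕ) :
    Measurable (block Xst Yobs j m) :=
  measurable_pi_iff.2 fun k => h.measurable_pair (j + k)

variable [IsMarkovKernel P] [IsMarkovKernel Q]

lemma lintegral_psi_stepKernel_le (hpsi : Measurable psi)
    (hK : ∀ x, ∫⁻ y, ENNReal.ofReal (psi y) ∂(Q x) ≤ ENNReal.ofReal K) (x : X) :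
    ∫⁻ z, ENNReal.ofReal (psi z.2) ∂(stepKernel P Q x) ≤ ENNReal.ofReal K := by
  rw [stepKernel, Kernel.lintegral_compProd _ _ _ (f := fun z : X × Y => ENNReal.ofReal (psi z.2))
    (hpsi.comp measurable_snd).ennreal_ofReal]
  refine (lintegral_mono (g := fun _ => ENNReal.ofReal K) fun x' => hK x').trans ?_
  simp

lemma integrable_psi_stepKernel (hpsi : Measurable psi) (hpsi0 : ∀ y, 0 < psi y)
    (hK : ∀ x, ∫⁻ y, ENNReal.ofReal (psi y) ∂(Q x) ≤ ENNReal.ofReal K) (x : X) :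
    Integrable (fun z : X × Y => psi z.2) (stepKernel P Q x) := by
  refine ⟨(hpsi.comp measurable_snd).aestronglyMeasurable, ?_⟩
  rw [hasFiniteIntegral_iff_ofReal (f := fun z : X × Y => psi z.2)
    (Eventually.of_forall fun z => (hpsi0 z.2).le)]
  exact (lintegral_psi_stepKernel_le hpsi hK x).trans_lt ENNReal.ofReal_lt_top

lemma integral_psi_stepKernel_le (hpsi : Measurable psi) (hpsi0 : ∀ y, 0 < psi y) (hK0 : 0 ≤ K)
    (hK : ∀ x, ∫⁻ y, ENNReal.ofReal (psi y) ∂(Q x) ≤ ENNReal.ofReal K) (x : X) :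
    ∫ z, psi z.2 ∂(stepKernel P Q x) ≤ K := by
  rw [← ENNReal.ofReal_le_ofReal_iff hK0, ofReal_integral_eq_lintegral_ofReal
    (integrable_psi_stepKernel hpsi hpsi0 hK x) (Eventually.of_forall fun z => (hpsi0 z.2).le)]
  exact lintegral_psi_stepKernel_le hpsi hK x

namespace IsHiddenMarkovModel

variable [IsProbabilityMeasure Pr]

lemma lintegral_psi_obs_le (h : IsHiddenMarkovModel Pr P Q Xst Yobs) (hpsi : Measurable psi)
    (hK : ∀ x, ∫⁻ y, ENNReal.ofReal (psi y) ∂(Q x) ≤ ENNReal.ofReal K) (n : ℕ) :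
    ∫⁻ ω, ENNReal.ofReal (psi (Yobs (n + 1) ω)) ∂Pr ≤ ENNReal.ofReal K := by
  rw [h.lintegral_history n (F := fun w => ENNReal.ofReal (psi w.2.2))
    (hpsi.comp (by fun_prop)).ennreal_ofReal]
  refine (lintegral_mono fun ω => lintegral_psi_stepKernel_le hpsi hK (Xst n ω)).trans ?_
  simp

lemma integrable_psi_obs (h : IsHiddenMarkovModel Pr P Q Xst Yobs) (hpsi : Measurable psi)
    (hpsi0 : ∀ y, 0 < psi y)
    (hK : ∀ x, ∫⁻ y, ENNReal.ofReal (psi y) ∂(Q x) ≤ ENNReal.ofReal K) (n : ℕ) :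
    Integrable (fun ω => psi (Yobs (n + 1) ω)) Pr := by
  refine ⟨(hpsi.comp (h.measurable_obs _)).aestronglyMeasurable, ?_⟩
  rw [hasFiniteIntegral_iff_ofReal (Eventually.of_forall fun ω => (hpsi0 _).le)]
  exact (h.lintegral_psi_obs_le hpsi hK n).trans_lt ENNReal.ofReal_lt_top

lemma integral_psi_obs_le (h : IsHiddenMarkovModel Pr P Q Xst Yobs) (hpsi : Measurable psi)
    (hpsi0 : ∀ y, 0 < psi y) (hK0 : 0 ≤ K)
    (hK : ∀ x, ∫⁻ y, ENNReal.ofReal (psi y) ∂(Q x) ≤ ENNReal.ofReal K) (n : ℕ) :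
    ∫ ω, psi (Yobs (n + 1) ω) ∂Pr ≤ K := by
  rw [← ENNReal.ofReal_le_ofReal_iff hK0, ofReal_integral_eq_lintegral_ofReal
    (h.integrable_psi_obs hpsi hpsi0 hK n) (Eventually.of_forall fun z => (hpsi0 _).le)]
  exact h.lintegral_psi_obs_le hpsi hK n

lemma integrable_block (h : IsHiddenMarkovModel Pr P Q Xst Yobs) (hpsi : Measurable psi)
    (hpsi0 : ∀ y, 0 < psi y)
    (hK : ∀ x, ∫⁻ y, ENNReal.ofReal (psi y) ∂(Q x) ≤ ENNReal.ofReal K) {m : ℕ} {A : ℝ}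
    {f : (Fin (m + 1) → X × Y) → ℝ} (hf : Measurable f)
    (hfb : ∀ z, |f z| ≤ A + ∑ k : Fin m, psi (z k.succ).2) (j : ℕ) :
    Integrable (fun ω => f (block Xst Yobs j m ω)) Pr := by
  refine Integrable.mono' (g := fun ω => A + ∑ k : Fin m, psi (Yobs (j + k + 1) ω)) ?_
    (hf.comp (h.measurable_block j m)).aestronglyMeasurable (Eventually.of_forall fun ω => ?_)
  · exact (integrable_const A).add
      (integrable_finsetSum _ fun k _ => h.integrable_psi_obs hpsi hpsi0 hK (j + k))
  · exact hfb _

/-- The conditional expectation of a function of a block of states and observations given the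
beginning of the block: a function of the beginning which does not depend on the time and which is
bounded although the given function need not be. -/
theorem exists_integral_block_eq (h : IsHiddenMarkovModel Pr P Q Xst Yobs) (hpsi : Measurable psi)
    (hpsi0 : ∀ y, 0 < psi y) (hK0 : 0 ≤ K)
    (hK : ∀ x, ∫⁻ y, ENNReal.ofReal (psi y) ∂(Q x) ≤ ENNReal.ofReal K) (m : ℕ) (A : ℝ)
    (f : (Fin (m + 1) → X × Y) → ℝ) (hf : Measurable f)
    (hfb : ∀ z, |f z| ≤ A + ∑ k : Fin m, psi (z k.succ).2) :
    ∃ G : X × Y → ℝ, Measurable G ∧ (∀ z, |G z| ≤ A + m * K) ∧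
      ∀ j, ∫ ω, f (block Xst Yobs j m ω) ∂Pr = ∫ ω, G (Xst j ω, Yobs j ω) ∂Pr := by
  induction m generalizing A with
  | zero =>
    refine ⟨fun z => f fun _ => z, hf.comp (measurable_pi_iff.2 fun _ => measurable_id),
      fun z => by simpa using hfb fun _ => z, fun j => ?_⟩
    congr 1
    funext ω
    congr 1
    funext k
    rw [Fin.fin_one_eq_zero k]
    rfl
  | succ m ih =>
    have hsnoc : Measurable fun w : (Fin (m + 1) → X × Y) × (X × Y) =>
        (Fin.snoc w.1 w.2 : Fin (m + 2) → X × Y) := by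
      refine measurable_pi_iff.2 fun i => ?_
      refine Fin.lastCases ?_ (fun k => ?_) i
      · simpa using measurable_snd
      · simpa using measurable_pi_iff.1 measurable_fst k
    let fbar : (Fin (m + 1) → X × Y) → ℝ := fun w =>
      ∫ z, f (Fin.snoc w z) ∂(stepKernel P Q (w (Fin.last m)).1)
    have hfbar : Measurable fbar := by
      have := StronglyMeasurable.integral_kernel_prod_right'
        (κ := (stepKernel P Q).comap (fun w : Fin (m + 1) → X × Y => (w (Fin.last m)).1)
          (by fun_prop)) (hf.comp hsnoc).stronglyMeasurable
      exact this.measurable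
    have hsum : ∀ (w : Fin (m + 1) → X × Y) (z : X × Y), |f (Fin.snoc w z)| ≤
        (A + ∑ k : Fin m, psi (w k.succ).2) + psi z.2 := by
      intro w z
      refine (hfb _).trans (le_of_eq ?_)
      rw [Fin.sum_univ_castSucc, ← add_assoc]
      congr 1
      · congr 1
        refine Finset.sum_congr rfl fun k _ => ?_
        rw [Fin.succ_castSucc, Fin.snoc_castSucc (α := fun _ => X × Y)]
      · rw [Fin.succ_last, Fin.snoc_last (α := fun _ => X × Y)]
    have hint : ∀ (w : Fin (m + 1) → X × Y), Integrable (fun z : X × Y =>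
        (A + ∑ k : Fin m, psi (w k.succ).2) + psi z.2) (stepKernel P Q (w (Fin.last m)).1) :=
      fun w => (integrable_const _).add (integrable_psi_stepKernel hpsi hpsi0 hK _)
    have hfbarb : ∀ w, |fbar w| ≤ (A + K) + ∑ k : Fin m, psi (w k.succ).2 := by
      intro w
      refine (norm_integral_le_of_norm_le (f := fun z => f (Fin.snoc w z)) (hint w)
        (Eventually.of_forall (hsum w))).trans ?_
      rw [integral_add (integrable_const _) (integrable_psi_stepKernel hpsi hpsi0 hK _)]
      have := integral_psi_stepKernel_le (P := P) hpsi hpsi0 hK0 hK (w (Fin.last m)).1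
      simp only [integral_const, probReal_univ, one_smul]
      linarith
    obtain ⟨G, hG, hGb, hGi⟩ := ih (A + K) fbar hfbar hfbarb
    refine ⟨G, hG, fun z => (hGb z).trans (le_of_eq (by push_cast; ring)), fun j => ?_⟩
    rw [← hGi j]
    -- the last `m + 1` terms of the history up to time `j + m`
    let restr : (Fin (j + m + 1) → X × Y) → Fin (m + 1) → X × Y :=
      fun w k => w ⟨j + k, by omega⟩
    have hrestr : Measurable restr := measurable_pi_iff.2 fun k => measurable_pi_apply _
    have hblock : ∀ ω, block Xst Yobs j (m + 1) ω = Fin.snoc (restr (history Xst Yobs (j + m) ω))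
        (Xst (j + m + 1) ω, Yobs (j + m + 1) ω) := by
      intro ω
      funext i
      refine Fin.lastCases ?_ (fun k => ?_) i
      · rw [Fin.snoc_last (α := fun _ => X × Y)]
        rfl
      · rw [Fin.snoc_castSucc (α := fun _ => X × Y)]
        rfl
    have hF : Measurable fun w : (Fin (j + m + 1) → X × Y) × (X × Y) =>
        f (Fin.snoc (restr w.1) w.2) :=
      hf.comp (hsnoc.comp ((hrestr.comp measurable_fst).prodMk measurable_snd))
    have hFint := h.integrable_block hpsi hpsi0 hK hf hfb j
    simp_rw [hblock] at hFint ⊢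
    exact h.integral_history (j + m) hF hFint

/-- Expectations of functions of a block converge geometrically fast as the block moves to infinity,
at a rate which is linear in the length of the block. -/
theorem exists_abs_integral_block_sub_le (h : IsHiddenMarkovModel Pr P Q Xst Yobs)
    (hpsi : Measurable psi) (hpsi0 : ∀ y, 0 < psi y) (hK0 : 0 ≤ K)
    (hK : ∀ x, ∫⁻ y, ENNReal.ofReal (psi y) ∂(Q x) ≤ ENNReal.ofReal K)
    {π : Measure X} [IsProbabilityMeasure π] {e : ℕ → ℝ}
    (he : ∀ x n B, MeasurableSet B → |((P ^ n) x).real B - π.real B| ≤ e n) (m : ℕ) (A : ℝ)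
    (f : (Fin (m + 1) → X × Y) → ℝ) (hf : Measurable f)
    (hfb : ∀ z, |f z| ≤ A + ∑ k : Fin m, psi (z k.succ).2) :
    (∀ j, |∫ ω, f (block Xst Yobs j m ω) ∂Pr| ≤ A + m * K) ∧
    ∃ β, ∀ j, |∫ ω, f (block Xst Yobs (j + 1) m ω) ∂Pr - β| ≤ 2 * (A + m * K) * e j := by
  obtain ⟨G, hG, hGb, hGi⟩ := h.exists_integral_block_eq hpsi hpsi0 hK0 hK m A f hf hfb
  refine ⟨fun j => ?_, ∫ x, ∫ z, G z ∂(stepKernel P Q x) ∂π, fun j => ?_⟩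
  · rw [hGi j]
    have := norm_integral_le_of_norm_le_const (μ := Pr) (C := A + m * K)
      (f := fun ω => G (Xst j ω, Yobs j ω)) (Eventually.of_forall fun ω => hGb _)
    simpa using this
  · have hGG : Measurable fun x => ∫ z, G z ∂(stepKernel P Q x) :=
      (hG.stronglyMeasurable.integral_kernel (κ := stepKernel P Q)).measurable
    have hGGb : ∀ x, |∫ z, G z ∂(stepKernel P Q x)| ≤ A + m * K := fun x => by
      have := norm_integral_le_of_norm_le_const (μ := stepKernel P Q x) (C := A + m * K)
        (f := G) (Eventually.of_forall fun z => hGb _)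
      simpa using this
    have h1 : ∫ ω, f (block Xst Yobs (j + 1) m ω) ∂Pr =
        ∫ x, ∫ z, G z ∂(stepKernel P Q x) ∂(Pr.map (Xst j)) := by
      rw [hGi (j + 1), integral_map (h.measurable_state j).aemeasurable hGG.aestronglyMeasurable]
      refine h.integral_history j (F := fun w => G w.2) (hG.comp measurable_snd) ?_
      exact Integrable.of_bound (hG.comp (h.measurable_pair (j + 1))).aestronglyMeasurable
        (A + m * K) (Eventually.of_forall fun ω => hGb _)
    have := Measure.isProbabilityMeasure_map (μ := Pr) (h.measurable_state j).aemeasurable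
    rw [h1]
    exact abs_integral_sub_integral_le hGG hGGb
      fun B hB => h.abs_law_state_sub_le (fun x B hB => he x j B hB) hB

end IsHiddenMarkovModel

end TrueModel

/-! ### Almost additive double sequences -/

/-- A doubly indexed sequence `c m j`, to be thought of as the mean of a functional of `m`
observations starting at time `j`, that is additive up to bounded errors and converges, uniformly
relative to `m`, as `j` tends to infinity, grows linearly in `m`. -/
theorem exists_tendsto_div_of_almost_additive {c : ℕ → ℕ → ℝ} {β : ℕ → ℝ} {C M : ℝ} {e : ℕ → ℝ}
    (hadd : ∀ n m j, |c (n + m) j - c n j - c m (j + n)| ≤ C) (hM : ∀ m j, |c m j| ≤ m * M)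
    (hβ : ∀ m j, |c m (j + 1) - β m| ≤ m * e j) (he : Tendsto e atTop (𝓝 0)) :
    ∃ L, Tendsto (fun n : ℕ => c n 0 / n) atTop (𝓝 L) := by
  have hcβ : ∀ m, Tendsto (fun j => c m (j + 1)) atTop (𝓝 (β m)) := fun m => by
    rw [tendsto_iff_dist_tendsto_zero]
    refine squeeze_zero (fun _ => dist_nonneg) (fun j => hβ m j) ?_
    simpa using he.const_mul (m : ℝ)
  have hβM : ∀ m, |β m| ≤ m * M := fun m =>
    le_of_tendsto (hcβ m).abs (Eventually.of_forall fun j => hM m (j + 1))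
  have hβadd : ∀ n m, |β (n + m) - β n - β m| ≤ C := fun n m => by
    have h1 : Tendsto (fun j => c m (j + n + 1)) atTop (𝓝 (β m)) :=
      (hcβ m).comp (tendsto_add_atTop_nat n)
    refine le_of_tendsto (((hcβ (n + m)).sub (hcβ n)).sub h1).abs (Eventually.of_forall fun j => ?_)
    have := hadd n m (j + 1)
    rwa [add_right_comm] at this
  have hC : 0 ≤ C := (abs_nonneg _).trans (hadd 0 0 0)
  have hM0 : 0 ≤ M := by simpa using (abs_nonneg _).trans (hM 1 0)
  have hsub : Subadditive fun n => β n + C := fun m n => by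
    have := (abs_le.1 (hβadd m n)).2
    linarith
  have hlim := hsub.tendsto_lim ⟨-M, by
    rintro _ ⟨n, rfl⟩
    rcases Nat.eq_zero_or_pos n with rfl | hn
    · simpa using hM0
    · have hn' : (0 : ℝ) < n := by exact_mod_cast hn
      rw [le_div_iff₀ hn']
      have := (abs_le.1 (hβM n)).1
      linarith⟩
  refine ⟨hsub.lim, ?_⟩
  have hkey : ∀ n j : ℕ, |c (n + (j + 1)) 0 - β (n + (j + 1))| ≤
      2 * (M * (j + 1) + C) + n * e j := by
    intro n j
    have h1 := abs_le.1 (hadd (j + 1) n 0)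
    have h2 := abs_le.1 (hβadd (j + 1) n)
    have h3 := abs_le.1 (hM (j + 1) 0)
    have h4 := abs_le.1 (hβM (j + 1))
    have h5 := abs_le.1 (hβ n j)
    rw [zero_add] at h1
    rw [add_comm n (j + 1)]
    push_cast at h3 h4
    rw [abs_le]
    constructor <;> nlinarith
  have hdiff : Tendsto (fun n : ℕ => (c n 0 - (β n + C)) / n) atTop (𝓝 0) := by
    rw [Metric.tendsto_atTop]
    intro ε hε
    obtain ⟨j, hj⟩ := (he.eventually (Metric.ball_mem_nhds 0 (half_pos hε))).exists
    rw [dist_zero_right, Real.norm_eq_abs] at hj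
    have hj := (abs_lt.1 hj).2
    have hlarge : Tendsto (fun n : ℕ => (ε / 2) * (n : ℝ)) atTop atTop :=
      tendsto_natCast_atTop_atTop.const_mul_atTop (half_pos hε)
    obtain ⟨N, hN⟩ := eventually_atTop.1
      (hlarge.eventually_gt_atTop (2 * (M * (j + 1) + C) + C))
    refine ⟨N + (j + 1), fun n hn => ?_⟩
    have hn0 : (0 : ℝ) < n := by exact_mod_cast (by omega : 0 < n)
    obtain ⟨n', rfl⟩ : ∃ n', n = n' + (j + 1) := ⟨n - (j + 1), by omega⟩
    have h1 := abs_le.1 (hkey n' j)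
    have h2 := hN (n' + (j + 1)) (by omega)
    have h3 : (n' : ℝ) * e j ≤ ε / 2 * ((n' + (j + 1) : ℕ) : ℝ) := by
      push_cast
      have : (0 : ℝ) ≤ n' := Nat.cast_nonneg n'
      have : (0 : ℝ) ≤ j := Nat.cast_nonneg j
      nlinarith
    rw [dist_zero_right, Real.norm_eq_abs, abs_div, abs_of_pos hn0, div_lt_iff₀ hn0, abs_lt]
    constructor <;> linarith
  have := hdiff.add hlim
  rw [zero_add] at this
  refine this.congr fun n => ?_
  rw [← add_div]
  ring_nf


/-! ### The log-likelihood of the candidate model -/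

section LogLikelihood

variable {d : ℕ} {X Y : Type*} [MeasurableSpace X] [MeasurableSpace Y]
  {μ : Measure X} {ν : Measure Y} {Θ : Set (EuclideanSpace ℝ (Fin d))}
  {p : EuclideanSpace ℝ (Fin d) → X → X → ℝ} {q : EuclideanSpace ℝ (Fin d) → Y → X → ℝ}
  {δ : ℝ} {rhat : EuclideanSpace ℂ (Fin d) → Y → X → X → ℂ}
  {vphi : EuclideanSpace ℂ (Fin d) → Y → ℂ} {phi psi : Y → ℝ}

lemma SeparatelyHarmonicOn.const_mul {U : (Fin d → ℂ) → ℝ} {c : Fin d → ℂ} {ρ : ℝ}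
    (hU : SeparatelyHarmonicOn U c ρ) (a : ℝ) : SeparatelyHarmonicOn (fun z => a * U z) c ρ :=
  ⟨continuousOn_const.mul hU.continuousOn,
    fun z hz i t ht => (hU.harmonic z hz i t ht).const_smul (c := a)⟩

lemma exists_polydisc_subset_ball (θ : EuclideanSpace ℝ (Fin d)) {R : ℝ} (hR : 0 < R) :
    ∃ ρ > 0, Metric.closedBall (fun i => (θ i : ℂ)) ρ ⊆
      WithLp.toLp 2 ⁻¹' Metric.ball (toComplexVec θ) R := by
  have h1 : WithLp.toLp 2 ⁻¹' Metric.ball (toComplexVec θ) R ∈ 𝓝 (fun i => (θ i : ℂ)) :=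
    (PiLp.continuous_toLp 2 (fun _ : Fin d => ℂ)).continuousAt.preimage_mem_nhds
      (Metric.ball_mem_nhds _ hR)
  exact Metric.nhds_basis_closedBall.mem_iff.1 h1

lemma rhat_iteratedIntegral_eq (h : AnalyticityCondition ν Θ p q δ rhat vphi phi psi)
    {θ : EuclideanSpace ℝ (Fin d)} (hθ : θ ∈ Θ) (n : ℕ) (y : ℕ → Y) (x : X) :
    iteratedIntegral μ (rhat (toComplexVec θ)) n y x =
      ((iteratedIntegral μ (transDensity p q θ) n y x : ℝ) : ℂ) := by
  rw [← iteratedIntegral_ofReal]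
  exact iteratedIntegral_congr x fun k _ x' x => h.rhat_eq θ hθ _ _ _

lemma abs_log_le_of_mem_Icc (h : AnalyticityCondition ν Θ p q δ rhat vphi phi psi)
    {θ : EuclideanSpace ℝ (Fin d)} (hθ : θ ∈ Θ) {γ κ : ℝ}
    (hr : IsMixingKernel μ (transDensity p q θ) (fun y => ‖vphi (toComplexVec θ) y‖) γ κ)
    (hμ : 0 < μ.real Set.univ) {n : ℕ} {y : ℕ → Y} {v : ℝ}
    (h1 : ∏ k ∈ Finset.range n, (γ * ‖vphi (toComplexVec θ) (y k)‖) ≤ v)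
    (h2 : v ≤ ∏ k ∈ Finset.range n, (μ.real Set.univ * ‖vphi (toComplexVec θ) (y k)‖)) :
    |Real.log v| ≤ ∑ k ∈ Finset.range n, (psi (y k) + logBound μ γ) := by
  have hγ := hr.gamma_pos
  refine abs_log_le_of_prod_bounds hγ hμ (fun k => hr.bound_pos (y k))
    (fun k => h.log_vphi_le _ (h.toComplexVec_mem hθ) (y k)) (le_trans ?_ h1) h2
  refine Finset.prod_le_prod (fun k _ => mul_nonneg (by positivity) (norm_nonneg _)) fun k _ => ?_
  exact mul_le_mul_of_nonneg_right (by linarith) (norm_nonneg _)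

variable [IsFiniteMeasure μ]

/-- The logarithm of the modulus of a zero-free iterated integral is separately harmonic in the
parameter. -/
theorem AnalyticityCondition.separatelyHarmonicOn_log
    (h : AnalyticityCondition ν Θ p q δ rhat vphi phi psi) {θ : EuclideanSpace ℝ (Fin d)}
    (hθ : θ ∈ Θ) {R : ℝ} (hRδ : R ≤ δ) {n : ℕ} {y : ℕ → Y} {x : X}
    (hne : ∀ η ∈ Metric.ball (toComplexVec θ) R, iteratedIntegral μ (rhat η) n y x ≠ 0) {ρ : ℝ}
    (hρ : Metric.closedBall (fun i => (θ i : ℂ)) ρ ⊆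
      WithLp.toLp 2 ⁻¹' Metric.ball (toComplexVec θ) R) :
    SeparatelyHarmonicOn
      (fun z => Real.log ‖iteratedIntegral μ (rhat (WithLp.toLp 2 z)) n y x‖)
      (fun i => (θ i : ℂ)) ρ := by
  have hV : ∀ η ∈ Metric.ball (toComplexVec θ) R, η ∈ vicinity δ Θ := fun η hη =>
    ball_subset_vicinity hθ (Metric.ball_subset_ball hRδ hη)
  have hb : ∀ η ∈ Metric.ball (toComplexVec θ) R, ∀ y x' x, ‖rhat η y x' x‖ ≤ phi y :=
    fun η hη y x' x => (h.rhat_le η (hV η hη) y x' x).trans (h.vphi_le η (hV η hη) y)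
  have htoLp : Continuous (WithLp.toLp 2 : (Fin d → ℂ) → EuclideanSpace ℂ (Fin d)) :=
    PiLp.continuous_toLp 2 _
  refine ⟨?_, fun z hz i t ht => ?_⟩
  · refine ContinuousOn.log ?_ fun z hz => norm_ne_zero_iff.2 (hne _ (hρ hz))
    refine ContinuousOn.norm ?_
    have := continuousOn_iteratedIntegral (μ := μ) (V := Metric.ball (toComplexVec θ) R)
      (fun η hη => h.rhat_measurable η (hV η hη)) hb
      (fun y x' x => ((h.rhat_analytic y x' x).continuousOn).mono hV) n y x
    exact this.comp htoLp.continuousOn hρ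
  · -- the coordinate line through `z` in the ball
    let V : Set ℂ := {t | WithLp.toLp 2 (Function.update z i t) ∈ Metric.ball (toComplexVec θ) R}
    have hVopen : IsOpen V :=
      Metric.isOpen_ball.preimage (htoLp.comp (continuous_const.update i continuous_id))
    have htV : t ∈ V := by
      have hρ0 : 0 ≤ ρ := dist_nonneg.trans ht
      refine hρ ?_
      rw [closedBall_pi _ hρ0] at hz ⊢
      intro j _
      by_cases hj : j = i
      · subst hj
        simpa using ht
      · simpa [hj] using hz j (Set.mem_univ j)
    have hline : Differentiable ℂ fun t : ℂ =>
        (WithLp.toLp 2 (Function.update z i t) : EuclideanSpace ℂ (Fin d)) := by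
      have h1 : Differentiable ℂ (Function.update z i) := fun t =>
        (hasDerivAt_update z i t).differentiableAt
      exact (PiLp.continuousLinearEquiv 2 ℂ fun _ : Fin d => ℂ).symm.differentiable.comp h1
    have hd := differentiableOn_iteratedIntegral (μ := μ) hVopen
      (R := fun t => rhat (WithLp.toLp 2 (Function.update z i t)))
      (fun t ht => h.rhat_measurable _ (hV _ ht)) (fun t ht => hb _ ht)
      (fun y x' x t ht => (DifferentiableAt.comp (g := fun η => rhat η y x' x) t
        (h.rhat_analytic y x' x _ (hV _ ht)).differentiableAt (hline t)).differentiableWithinAt)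
      n y x
    exact (hd.analyticOnNhd hVopen t htV).harmonicAt_log_norm (hne _ htV)

lemma AnalyticityCondition.abs_log_norm_iteratedIntegral_le
    (h : AnalyticityCondition ν Θ p q δ rhat vphi phi psi) {γ : ℝ} (hγ : 0 < γ)
    (hμ : 0 < μ.real Set.univ) {η : EuclideanSpace ℂ (Fin d)} (hη : η ∈ vicinity δ Θ) {n : ℕ}
    {y : ℕ → Y} {x : X} (hlow : ∏ k ∈ Finset.range n, (γ / 4 * ‖vphi η (y k)‖) ≤
      ‖iteratedIntegral μ (rhat η) n y x‖) :
    |Real.log ‖iteratedIntegral μ (rhat η) n y x‖| ≤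
      ∑ k ∈ Finset.range n, (psi (y k) + logBound μ γ) :=
  abs_log_le_of_prod_bounds hγ hμ (fun k => norm_pos_iff.2 (h.vphi_ne_zero η hη (y k)))
    (fun k => h.log_vphi_le η hη (y k)) hlow (norm_iteratedIntegral_le (h.rhat_le η hη) n y x)

lemma obsDensity_mem_Icc {θ : EuclideanSpace ℝ (Fin d)} {a : Y → ℝ} {γ κ : ℝ}
    (hr : IsMixingKernel μ (transDensity p q θ) a γ κ) (lam : Measure X) [IsProbabilityMeasure lam]
    (n : ℕ) (y : ℕ → Y) {v₁ v₂ : ℝ}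
    (h1 : ∀ x, v₁ ≤ iteratedIntegral μ (transDensity p q θ) n y x)
    (h2 : ∀ x, iteratedIntegral μ (transDensity p q θ) n y x ≤ v₂) :
    ENNReal.ofReal v₁ ≤ obsDensity μ p q θ lam n (fun k => y k) ∧
      obsDensity μ p q θ lam n (fun k => y k) ≤ ENNReal.ofReal v₂ := by
  rw [obsDensity_eq_lintegral hr]
  constructor
  · refine le_trans (by simp)
      (lintegral_mono (f := fun _ => ENNReal.ofReal v₁) fun x => ENNReal.ofReal_le_ofReal (h1 x))
  · refine le_trans
      (lintegral_mono (g := fun _ => ENNReal.ofReal v₂) fun x => ENNReal.ofReal_le_ofReal (h2 x))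
      (by simp)

lemma toReal_obsDensity_mem_Icc {θ : EuclideanSpace ℝ (Fin d)} {a : Y → ℝ} {γ κ : ℝ}
    (hr : IsMixingKernel μ (transDensity p q θ) a γ κ) (lam : Measure X) [IsProbabilityMeasure lam]
    (n : ℕ) (y : ℕ → Y) {v₁ v₂ : ℝ} (hv₁ : 0 ≤ v₁)
    (h1 : ∀ x, v₁ ≤ iteratedIntegral μ (transDensity p q θ) n y x)
    (h2 : ∀ x, iteratedIntegral μ (transDensity p q θ) n y x ≤ v₂) :
    v₁ ≤ (obsDensity μ p q θ lam n (fun k => y k)).toReal ∧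
      (obsDensity μ p q θ lam n (fun k => y k)).toReal ≤ v₂ := by
  obtain ⟨h3, h4⟩ := obsDensity_mem_Icc hr lam n y h1 h2
  obtain ⟨x⟩ : Nonempty X := nonempty_of_isProbabilityMeasure lam
  refine ⟨?_, ENNReal.toReal_le_of_le_ofReal (hv₁.trans ((h1 x).trans (h2 x))) h4⟩
  rw [← ENNReal.toReal_ofReal hv₁]
  exact ENNReal.toReal_mono (h4.trans_lt ENNReal.ofReal_lt_top).ne h3

lemma IsMixingKernel.iteratedIntegral_le {r : Y → X → X → ℝ} {a : Y → ℝ} {γ κ : ℝ}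
    (hr : IsMixingKernel μ r a γ κ) (n : ℕ) (y : ℕ → Y) (x : X) :
    iteratedIntegral μ r n y x ≤ ∏ k ∈ Finset.range n, (μ.real Set.univ * a (y k)) :=
  (le_abs_self _).trans (norm_iteratedIntegral_le hr.norm_le n y x)

lemma obsDensity_pos_and_lt_top [Nonempty Y] {θ : EuclideanSpace ℝ (Fin d)} {a : Y → ℝ} {γ κ : ℝ}
    (hr : IsMixingKernel μ (transDensity p q θ) a γ κ) (lam : Measure X) [IsProbabilityMeasure lam]
    (n : ℕ) (y : Fin n → Y) :
    0 < obsDensity μ p q θ lam n y ∧ obsDensity μ p q θ lam n y < ∞ := by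
  let y' : ℕ → Y := fun k => if hk : k < n then y ⟨k, hk⟩ else Classical.arbitrary Y
  have hy : y = fun k : Fin n => y' k := by
    funext k
    simp [y']
  obtain ⟨h1, h2⟩ := obsDensity_mem_Icc hr lam n y' (hr.le_iteratedIntegral n y')
    (hr.iteratedIntegral_le n y')
  rw [hy]
  refine ⟨lt_of_lt_of_le ?_ h1, h2.trans_lt ENNReal.ofReal_lt_top⟩
  rw [ENNReal.ofReal_pos]
  exact Finset.prod_pos fun k _ => mul_pos hr.gamma_pos (hr.bound_pos _)

/-- The initial distribution changes the log-likelihood by a bounded amount only. -/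
lemma abs_log_obsDensity_sub_le {θ : EuclideanSpace ℝ (Fin d)} {a : Y → ℝ} {γ κ : ℝ}
    (hr : IsMixingKernel μ (transDensity p q θ) a γ κ) (lam : Measure X) [IsProbabilityMeasure lam]
    (n : ℕ) (y : ℕ → Y) (x₀ : X) :
    |Real.log (obsDensity μ p q θ lam n (fun k => y k)).toReal -
      Real.log (iteratedIntegral μ (transDensity p q θ) n y x₀)| ≤ -Real.log κ := by
  have hκ := hr.kappa_pos
  have hpos := hr.iteratedIntegral_pos n y x₀
  obtain ⟨h1, h2⟩ := toReal_obsDensity_mem_Icc hr lam n y (mul_pos hκ hpos).le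
    (fun x => hr.compare_iteratedIntegral n y x₀ x)
    (v₂ := iteratedIntegral μ (transDensity p q θ) n y x₀ / κ)
    (fun x => by
      rw [le_div_iff₀ hκ, mul_comm]
      exact hr.compare_iteratedIntegral n y x x₀)
  have h3 := Real.log_le_log (mul_pos hκ hpos) h1
  have h4 := Real.log_le_log ((mul_pos hκ hpos).trans_le h1) h2
  rw [Real.log_mul hκ.ne' hpos.ne'] at h3
  rw [Real.log_div hpos.ne' hκ.ne'] at h4
  rw [abs_le]
  constructor <;> linarith

variable {Ω : Type*} [MeasurableSpace Ω] {Pr : Measure Ω} {P : Kernel X X} {Q : Kernel X Y}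
  {Xst : ℕ → Ω → X} {Yobs : ℕ → Ω → Y} {K : ℝ}

lemma measurable_toReal_obsDensity (hXY : IsHiddenMarkovModel Pr P Q Xst Yobs)
    {θ : EuclideanSpace ℝ (Fin d)} {a : Y → ℝ} {γ κ : ℝ}
    (hr : IsMixingKernel μ (transDensity p q θ) a γ κ) (lam : Measure X) [IsProbabilityMeasure lam]
    (n : ℕ) : Measurable fun ω =>
      (obsDensity μ p q θ lam n (fun k : Fin n => Yobs (k + 1) ω)).toReal := by
  have h1 : Measurable fun ω => fun k => Yobs (k + 1) ω :=
    measurable_pi_iff.2 fun k => hXY.measurable_obs (k + 1)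
  have h2 : Measurable fun y : ℕ → Y =>
      ∫⁻ x₀, ENNReal.ofReal (iteratedIntegral μ (transDensity p q θ) n y x₀) ∂lam :=
    (measurable_iteratedIntegral hr.measurable n).ennreal_ofReal.lintegral_prod_right'
  have h3 : ∀ ω, obsDensity μ p q θ lam n (fun k : Fin n => Yobs (k + 1) ω) = _ := fun ω =>
    obsDensity_eq_lintegral hr lam n fun k => Yobs (k + 1) ω
  simp_rw [h3]
  exact (h2.comp h1).ennreal_toReal

variable [IsProbabilityMeasure Pr] [IsMarkovKernel P] [IsMarkovKernel Q]

lemma integrable_sum_psi (hXY : IsHiddenMarkovModel Pr P Q Xst Yobs) (hpsi : Measurable psi)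
    (hpsi0 : ∀ y, 0 < psi y)
    (hK : ∀ x, ∫⁻ y, ENNReal.ofReal (psi y) ∂(Q x) ≤ ENNReal.ofReal K) (n : ℕ) (C : ℝ) :
    Integrable (fun ω => ∑ k ∈ Finset.range n, (psi (Yobs (k + 1) ω) + C)) Pr :=
  integrable_finsetSum _ fun k _ =>
    (hXY.integrable_psi_obs hpsi hpsi0 hK k).add (integrable_const C)

lemma integrable_avgLogLikelihood (hXY : IsHiddenMarkovModel Pr P Q Xst Yobs)
    (h : AnalyticityCondition ν Θ p q δ rhat vphi phi psi)
    (hK : ∀ x, ∫⁻ y, ENNReal.ofReal (psi y) ∂(Q x) ≤ ENNReal.ofReal K)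
    {θ : EuclideanSpace ℝ (Fin d)} (hθ : θ ∈ Θ) {γ κ : ℝ}
    (hr : IsMixingKernel μ (transDensity p q θ) (fun y => ‖vphi (toComplexVec θ) y‖) γ κ)
    (hμ : 0 < μ.real Set.univ) (lam : Measure X) [IsProbabilityMeasure lam] (n : ℕ) :
    Integrable (avgLogLikelihood μ p q Yobs θ lam n) Pr := by
  refine Integrable.const_mul ?_ _
  refine Integrable.mono' (integrable_sum_psi hXY h.psi_measurable h.psi_pos hK n (logBound μ γ))
    (measurable_toReal_obsDensity hXY hr lam n).log.aestronglyMeasurable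
    (Eventually.of_forall fun ω => ?_)
  obtain ⟨h1, h2⟩ := toReal_obsDensity_mem_Icc hr lam n (fun k => Yobs (k + 1) ω)
    (Finset.prod_nonneg fun k _ => mul_nonneg hr.gamma_pos.le (norm_nonneg _))
    (hr.le_iteratedIntegral n _) (hr.iteratedIntegral_le n _)
  exact abs_log_le_of_mem_Icc h hθ hr hμ h1 h2

/-- The expectation of the logarithm of the iterated integral over the `m` observations following
time `j`. -/
def meanLog (Pr : Measure Ω) (μ : Measure X) (r : Y → X → X → ℝ) (Yobs : ℕ → Ω → Y) (x₀ : X)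
    (m j : ℕ) : ℝ :=
  ∫ ω, Real.log (iteratedIntegral μ r m (fun k => Yobs (j + k + 1) ω) x₀) ∂Pr

/-- Convergence of the log-likelihood, normalized by the number of observations, for a deterministic
initial state. -/
theorem exists_tendsto_meanLog_div (hXY : IsHiddenMarkovModel Pr P Q Xst Yobs)
    (h : AnalyticityCondition ν Θ p q δ rhat vphi phi psi) (htrue : TrueModelCondition P Q psi)
    {θ : EuclideanSpace ℝ (Fin d)} (hθ : θ ∈ Θ) {γ κ : ℝ}
    (hr : IsMixingKernel μ (transDensity p q θ) (fun y => ‖vphi (toComplexVec θ) y‖) γ κ)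
    (hμ : 0 < μ.real Set.univ) (x₀ : X) :
    ∃ L, Tendsto (fun n : ℕ => meanLog Pr μ (transDensity p q θ) Yobs x₀ n 0 / n) atTop (𝓝 L) := by
  obtain ⟨K, hK1, hK, π, hπ, ρ, hρ0, hρ1, hπK⟩ := htrue
  have hK0 : 0 ≤ K := by linarith
  set r := transDensity p q θ with hrdef
  set C := logBound μ γ with hC
  -- the log-likelihood of `m` observations as a function of a block of length `m + 1`
  let f : ∀ m : ℕ, (Fin (m + 1) → X × Y) → ℝ := fun m z =>
    Real.log (iteratedIntegral μ r m (fun k => (z (Fin.ofNat (m + 1) (k + 1))).2) x₀)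
  have hf : ∀ m, Measurable (f m) := fun m =>
    ((measurable_iteratedIntegral_left hr.measurable m x₀).comp
      (f := fun (z : Fin (m + 1) → X × Y) (k : ℕ) => (z (Fin.ofNat (m + 1) (k + 1))).2)
      (measurable_pi_iff.2 fun k => by fun_prop)).log
  have hfb : ∀ m z, |f m z| ≤ m * C + ∑ k : Fin m, psi (z k.succ).2 := by
    intro m z
    refine (abs_log_le_of_mem_Icc h hθ hr hμ (hr.le_iteratedIntegral m _ x₀)
      (hr.iteratedIntegral_le m _ x₀)).trans (le_of_eq ?_)
    rw [Finset.sum_add_distrib, Finset.sum_const, Finset.card_range, nsmul_eq_mul, add_comm,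
      Finset.sum_range]
    congr 1
    refine Finset.sum_congr rfl fun k _ => ?_
    congr 3
    ext
    simp [Nat.mod_eq_of_lt]
  have hfblock : ∀ m j ω, f m (block Xst Yobs j m ω) =
      Real.log (iteratedIntegral μ r m (fun k => Yobs (j + k + 1) ω) x₀) := by
    intro m j ω
    simp only [f]
    congr 1
    refine iteratedIntegral_congr x₀ fun k hk x' x => ?_
    have : (k + 1) % (m + 1) = k + 1 := Nat.mod_eq_of_lt (by omega)
    simp [block, this, add_assoc]
  have hint : ∀ m j, Integrable (fun ω =>
      Real.log (iteratedIntegral μ r m (fun k => Yobs (j + k + 1) ω) x₀)) Pr := fun m j =>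
    (hXY.integrable_block h.psi_measurable h.psi_pos hK (hf m) (hfb m) j).congr
      (Eventually.of_forall fun ω => hfblock m j ω)
  have hmean : ∀ m j, ∫ ω, f m (block Xst Yobs j m ω) ∂Pr = meanLog Pr μ r Yobs x₀ m j :=
    fun m j => integral_congr_ae (Eventually.of_forall fun ω => hfblock m j ω)
  have hmain := fun m => hXY.exists_abs_integral_block_sub_le h.psi_measurable h.psi_pos hK0 hK
    (e := fun n => K * ρ ^ n) (fun x n B hB => hπK x n B hB) m (m * C) (f m) (hf m) (hfb m)
  simp_rw [hmean] at hmain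
  choose β hβ using fun m => (hmain m).2
  refine exists_tendsto_div_of_almost_additive (c := meanLog Pr μ r Yobs x₀) (β := β)
    (C := -Real.log κ) (M := C + K) (e := fun j => 2 * (C + K) * (K * ρ ^ j)) (fun n m j => ?_)
    (fun m j => ((hmain m).1 j).trans (le_of_eq (by ring)))
    (fun m j => (hβ m j).trans (le_of_eq (by ring))) ?_
  · have hshift : meanLog Pr μ r Yobs x₀ m (j + n) = ∫ ω, Real.log (iteratedIntegral μ r m
        (fun k => (fun k => Yobs (j + k + 1) ω) (k + n)) x₀) ∂Pr := by
      unfold meanLog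
      congr! 7 with ω k
      ring
    have hint' : Integrable (fun ω => Real.log (iteratedIntegral μ r m
        (fun k => (fun k => Yobs (j + k + 1) ω) (k + n)) x₀)) Pr := by
      refine (hint m (j + n)).congr (Eventually.of_forall fun ω => ?_)
      beta_reduce
      congr! 5 with k
      ring
    have hint'' : Integrable (fun ω =>
        Real.log (iteratedIntegral μ r (n + m) (fun k => Yobs (j + k + 1) ω) x₀) -
          Real.log (iteratedIntegral μ r n (fun k => Yobs (j + k + 1) ω) x₀)) Pr :=
      (hint _ _).sub (hint _ _)
    rw [hshift]
    unfold meanLog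
    rw [← integral_sub (hint _ _) (hint _ _), ← integral_sub hint'' hint']
    rw [← Real.norm_eq_abs]
    refine (norm_integral_le_of_norm_le_const (C := -Real.log κ) (Eventually.of_forall fun ω =>
      hr.abs_log_iteratedIntegral_add n m (fun k => Yobs (j + k + 1) ω) x₀ x₀)).trans ?_
    simp
  · have := ((tendsto_pow_atTop_nhds_zero_of_lt_one hρ0.le hρ1).const_mul K).const_mul
      (2 * (C + K))
    simpa using this

lemma abs_expLogLikelihood_sub_le (hXY : IsHiddenMarkovModel Pr P Q Xst Yobs)
    (h : AnalyticityCondition ν Θ p q δ rhat vphi phi psi)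
    (hK : ∀ x, ∫⁻ y, ENNReal.ofReal (psi y) ∂(Q x) ≤ ENNReal.ofReal K)
    {θ : EuclideanSpace ℝ (Fin d)} (hθ : θ ∈ Θ) {γ κ : ℝ}
    (hr : IsMixingKernel μ (transDensity p q θ) (fun y => ‖vphi (toComplexVec θ) y‖) γ κ)
    (hμ : 0 < μ.real Set.univ) (lam : Measure X) [IsProbabilityMeasure lam] (x₀ : X) (n : ℕ) :
    |expLogLikelihood Pr μ p q Yobs θ lam n -
      meanLog Pr μ (transDensity p q θ) Yobs x₀ n 0 / n| ≤ -Real.log κ / n := by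
  have hint1 := integrable_avgLogLikelihood hXY h hK hθ hr hμ lam n
  have hint2 : Integrable (fun ω => 1 / (n : ℝ) * Real.log
      (iteratedIntegral μ (transDensity p q θ) n (fun k => Yobs (k + 1) ω) x₀)) Pr := by
    refine Integrable.const_mul (Integrable.mono'
      (integrable_sum_psi hXY h.psi_measurable h.psi_pos hK n (logBound μ γ)) ?_
      (Eventually.of_forall fun ω => abs_log_le_of_mem_Icc h hθ hr hμ
        (hr.le_iteratedIntegral n _ x₀) (hr.iteratedIntegral_le n _ x₀))) _
    exact ((measurable_iteratedIntegral_left hr.measurable n x₀).comp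
      (measurable_pi_iff.2 fun k => hXY.measurable_obs (k + 1))).log.aestronglyMeasurable
  have e : meanLog Pr μ (transDensity p q θ) Yobs x₀ n 0 / n = ∫ ω, 1 / (n : ℝ) * Real.log
      (iteratedIntegral μ (transDensity p q θ) n (fun k => Yobs (k + 1) ω) x₀) ∂Pr := by
    rw [integral_const_mul, meanLog, div_eq_mul_one_div, mul_comm]
    simp_rw [zero_add]
  rw [e, expLogLikelihood, ← integral_sub hint1 hint2]
  have := norm_integral_le_of_norm_le_const (μ := Pr) (C := -Real.log κ / n)
    (f := fun ω => avgLogLikelihood μ p q Yobs θ lam n ω - 1 / (n : ℝ) * Real.log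
      (iteratedIntegral μ (transDensity p q θ) n (fun k => Yobs (k + 1) ω) x₀))
    (Eventually.of_forall fun ω => by
      rw [avgLogLikelihood, ← mul_sub, norm_mul, Real.norm_of_nonneg (by positivity),
        div_mul_eq_mul_div, one_mul]
      exact div_le_div_of_nonneg_right
        (abs_log_obsDensity_sub_le hr lam n (fun k => Yobs (k + 1) ω) x₀) (Nat.cast_nonneg n))
  simpa using this

/-- Any pointwise limit of the normalized expected log-likelihoods is real-analytic. -/
theorem analyticAt_of_tendsto_meanLog_div (hXY : IsHiddenMarkovModel Pr P Q Xst Yobs)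
    (h : AnalyticityCondition ν Θ p q δ rhat vphi phi psi) (hK0 : 0 ≤ K)
    (hK : ∀ x, ∫⁻ y, ENNReal.ofReal (psi y) ∂(Q x) ≤ ENNReal.ofReal K) (hΘ : IsOpen Θ)
    {θ : EuclideanSpace ℝ (Fin d)} (hθ : θ ∈ Θ) {γ κ : ℝ}
    (hr : IsMixingKernel μ (transDensity p q θ) (fun y => ‖vphi (toComplexVec θ) y‖) γ κ)
    (hμ : 0 < μ.real Set.univ) (x₀ : X) {l : EuclideanSpace ℝ (Fin d) → ℝ}
    (hl : ∀ θ ∈ Θ, Tendsto (fun n : ℕ => meanLog Pr μ (transDensity p q θ) Yobs x₀ n 0 / n) atTop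
      (𝓝 (l θ))) : AnalyticAt ℝ l θ := by
  obtain ⟨R, hR, hRδ, hlow⟩ := exists_ball_le_norm_iteratedIntegral h hθ hr
  obtain ⟨ρ, hρ, hsub⟩ := exists_polydisc_subset_ball θ hR
  have hV : ∀ z ∈ Metric.closedBall (fun i => (θ i : ℂ)) ρ,
      (WithLp.toLp 2 z : EuclideanSpace ℂ (Fin d)) ∈ vicinity δ Θ := fun z hz =>
    ball_subset_vicinity hθ (Metric.ball_subset_ball hRδ (hsub hz))
  have hC : 0 ≤ logBound μ γ := add_nonneg (abs_nonneg _) (abs_nonneg _)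
  refine analyticAt_of_tendsto_integral_harmonic Pr θ hρ
    (U := fun n ω z => 1 / (n : ℝ) * Real.log
      ‖iteratedIntegral μ (rhat (WithLp.toLp 2 z)) n (fun k => Yobs (k + 1) ω) x₀‖)
    (B := fun n ω => 1 / (n : ℝ) *
      ∑ k ∈ Finset.range n, (psi (Yobs (k + 1) ω) + logBound μ γ))
    (M := K + logBound μ γ) (fun n ω => ?_) (fun n z hz => ?_) (fun n ω z hz => ?_) (fun n => ?_)
    (fun n => ?_) l ?_
  · refine (h.separatelyHarmonicOn_log hθ hRδ (fun η hη => ?_) hsub).const_mul _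
    refine norm_pos_iff.1 (lt_of_lt_of_le (Finset.prod_pos fun k _ => ?_) (hlow η hη n _ x₀))
    exact mul_pos (div_pos hr.gamma_pos (by norm_num)) (norm_pos_iff.2 (h.vphi_ne_zero η
      (ball_subset_vicinity hθ (Metric.ball_subset_ball hRδ hη)) _))
  · exact ((measurable_iteratedIntegral_left (h.rhat_measurable _ (hV z hz)) n x₀).comp
      (measurable_pi_iff.2 fun k => hXY.measurable_obs (k + 1))).norm.log.const_mul _
  · rw [abs_mul, abs_of_nonneg (by positivity : (0 : ℝ) ≤ 1 / n)]
    exact mul_le_mul_of_nonneg_left (h.abs_log_norm_iteratedIntegral_le hr.gamma_pos hμ (hV z hz)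
      (hlow _ (hsub hz) n _ x₀)) (by positivity)
  · exact (integrable_sum_psi hXY h.psi_measurable h.psi_pos hK n _).const_mul _
  · have hterm : ∀ k, Integrable (fun ω => psi (Yobs (k + 1) ω) + logBound μ γ) Pr := fun k =>
      (hXY.integrable_psi_obs h.psi_measurable h.psi_pos hK k).add (integrable_const _)
    rw [integral_const_mul, integral_finsetSum _ fun k _ => hterm k]
    have h1 : ∑ k ∈ Finset.range n, ∫ ω, (psi (Yobs (k + 1) ω) + logBound μ γ) ∂Pr ≤
        n * (K + logBound μ γ) := by
      refine (Finset.sum_le_card_nsmul _ _ (K + logBound μ γ) fun k _ => ?_).trans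
        (by rw [Finset.card_range, nsmul_eq_mul])
      rw [integral_add (hXY.integrable_psi_obs h.psi_measurable h.psi_pos hK k)
        (integrable_const _)]
      have := hXY.integral_psi_obs_le h.psi_measurable h.psi_pos hK0 hK k
      simp only [integral_const, probReal_univ, one_smul]
      linarith
    rcases Nat.eq_zero_or_pos n with rfl | hn
    · simpa using add_nonneg hK0 hC
    · have hn' : (0 : ℝ) < n := by exact_mod_cast hn
      rw [one_div, inv_mul_le_iff₀ hn']
      exact h1
  · filter_upwards [hΘ.mem_nhds hθ] with θ' hθ'
    refine (hl θ' hθ').congr fun n => ?_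
    rw [integral_const_mul, meanLog, div_eq_mul_one_div, mul_comm]
    congr 1
    refine integral_congr_ae (Eventually.of_forall fun ω => ?_)
    have e : (WithLp.toLp 2 (fun i => (θ' i : ℂ)) : EuclideanSpace ℂ (Fin d)) = toComplexVec θ' :=
      rfl
    beta_reduce
    rw [e, rhat_iteratedIntegral_eq h hθ', Complex.norm_real, Real.norm_eq_abs, Real.log_abs]
    simp_rw [zero_add]

end LogLikelihood

end

end HMMRate

theorem theorem1 {d dx dy : ℕ}
    {𝒳 : Set (EuclideanSpace ℝ (Fin dx))} (h𝒳 : MeasurableSet 𝒳)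
    {𝒴 : Set (EuclideanSpace ℝ (Fin dy))} (h𝒴 : MeasurableSet 𝒴)
    -- the true hidden Markov model
    {Ω : Type*} [MeasurableSpace Ω] (Pr : Measure Ω) [IsProbabilityMeasure Pr]
    (P : Kernel 𝒳 𝒳) [IsMarkovKernel P] (Q : Kernel 𝒳 𝒴) [IsMarkovKernel Q]
    (Xst : ℕ → Ω → 𝒳) (Yobs : ℕ → Ω → 𝒴)
    (hXY : HMMRate.IsHiddenMarkovModel Pr P Q Xst Yobs)
    -- the parametrized family of candidate models
    (Θ : Set (EuclideanSpace ℝ (Fin d))) (hΘ : IsOpen Θ)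
    (μ : Measure 𝒳) [IsFiniteMeasure μ] (ν : Measure 𝒴)
    (p : EuclideanSpace ℝ (Fin d) → 𝒳 → 𝒳 → ℝ) (q : EuclideanSpace ℝ (Fin d) → 𝒴 → 𝒳 → ℝ)
    (hpq : HMMRate.IsDensityFamily μ ν Θ p q)
    -- the assumptions on the candidate models
    (hmix : HMMRate.MixingCondition μ Θ p q)
    (δ : ℝ) (rhat : EuclideanSpace ℂ (Fin d) → 𝒴 → 𝒳 → 𝒳 → ℂ)
    (vphi : EuclideanSpace ℂ (Fin d) → 𝒴 → ℂ) (phi psi : 𝒴 → ℝ)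
    (hanalytic : HMMRate.AnalyticityCondition ν Θ p q δ rhat vphi phi psi)
    (hlower : HMMRate.LowerBoundCondition μ Θ p q vphi)
    -- the assumption on the true model
    (htrue : HMMRate.TrueModelCondition P Q psi) :
    -- the expected log-likelihoods are well-defined
    (∀ θ ∈ Θ, ∀ lam : Measure 𝒳, IsProbabilityMeasure lam → ∀ n : ℕ,
      (∀ y : Fin n → 𝒴, 0 < HMMRate.obsDensity μ p q θ lam n y ∧
        HMMRate.obsDensity μ p q θ lam n y < ∞) ∧
      Integrable (HMMRate.avgLogLikelihood μ p q Yobs θ lam n) Pr) ∧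
    -- they converge to a real-analytic limit that does not depend on the initial distribution
    ∃ l : EuclideanSpace ℝ (Fin d) → ℝ, AnalyticOnNhd ℝ l Θ ∧
      ∀ θ ∈ Θ, ∀ lam : Measure 𝒳, IsProbabilityMeasure lam →
        Tendsto (fun n => HMMRate.expLogLikelihood Pr μ p q Yobs θ lam n) atTop (𝓝 (l θ)) := by
  obtain ⟨ω₀⟩ : Nonempty Ω := nonempty_of_isProbabilityMeasure Pr
  have : Nonempty 𝒴 := ⟨Yobs 0 ω₀⟩
  obtain ⟨γ, κ, hr⟩ := HMMRate.exists_isMixingKernel_transDensity hpq hmix hanalytic hlower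
  have hμ : ∀ θ ∈ Θ, 0 < μ.real Set.univ := fun θ hθ =>
    (hr θ hθ).measure_pos (Yobs 0 ω₀) (Xst 0 ω₀)
  obtain ⟨K, hK1, hK, -⟩ := id htrue
  have hl : ∀ θ, ∃ L, θ ∈ Θ → Tendsto (fun n : ℕ =>
      HMMRate.meanLog Pr μ (HMMRate.transDensity p q θ) Yobs (Xst 0 ω₀) n 0 / n) atTop (𝓝 L) := by
    intro θ
    by_cases hθ : θ ∈ Θ
    · obtain ⟨L, hL⟩ := HMMRate.exists_tendsto_meanLog_div hXY hanalytic htrue hθ (hr θ hθ)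
        (hμ θ hθ) (Xst 0 ω₀)
      exact ⟨L, fun _ => hL⟩
    · exact ⟨0, fun h => absurd h hθ⟩
  choose l hl using hl
  refine ⟨fun θ hθ lam hlam n => ⟨fun y => HMMRate.obsDensity_pos_and_lt_top (hr θ hθ) lam n y,
    HMMRate.integrable_avgLogLikelihood hXY hanalytic hK hθ (hr θ hθ) (hμ θ hθ) lam n⟩,
    l, fun θ hθ => HMMRate.analyticAt_of_tendsto_meanLog_div hXY hanalytic (by linarith) hK hΘ hθ
      (hr θ hθ) (hμ θ hθ) (Xst 0 ω₀) hl, fun θ hθ lam hlam => ?_⟩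
  refine (hl θ hθ).congr_dist ?_
  refine squeeze_zero (fun _ => dist_nonneg) (fun n => ?_)
    (tendsto_const_div_atTop_nhds_zero_nat (-Real.log κ))
  rw [dist_comm, Real.dist_eq]
  exact HMMRate.abs_expLogLikelihood_sub_le hXY hanalytic hK hθ (hr θ hθ) (hμ θ hθ) lam
    (Xst 0 ω₀) n
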